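/- **Proposition.** Let $T>0$, $N\in\mathbb N$, $\tilde T=2T$ and $I=\{-2N+1,\dots,0\}$. *The line ensemble.* Consider $2N$ lines $H_j:[0,T\sqrt2]\to\mathbb Z$, $j\in I$, which start at $H_j(0)=j$ and change only by finitely many jumps by $+1$. A configuration of lines is allowed if the lines do not intersect, i.e. $H_j(s)<H_{j+1}(s)$ for all $j<0$ and all $s$, and if $H_j(T\sqrt2)-H_j(0)$ is even for every $j\in I$. The allowed configurations carry the probability measure proportional to $\sqrt2^{\,\#\text{jumps}}$ times the uniform measure (Lebesgue measure on the ordered jump times $0<t_1<\dots<t_k<T\sqrt2$ of all lines, times counting measure on the assignments of the $k$ jumps to the lines, summed over $k\ge 0$); this is a finite non-zero measure before normalization. For $x_1,\dots,x_n\in\mathbb Z$ let $$\rho^{(n)}(x_1,\dots,x_n)=\sum_{\substack{j_1,\dots,j_n\in I\\ \text{pairwise distinct}}}\mathbb P\big(H_{j_1}(T\sqrt2)=x_1,\dots,H_{j_n}(T\sqrt2)=x_n\big)$$ be the $n$-point correlation function of the process of end points $\{H_j(T\sqrt2)\}_{j\in I}$. *The kernel.* For $x,y,i\in\mathbb Z$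 let $\Phi_{x,i}=\tilde T^{\,x-i}/(x-i)!$ if $x\ge i$ and $\Phi_{x,i}=0$ otherwise, and $$S_{x,y}=\frac{1+\operatorname{sgn}(x-y)(-1)^x}{2}\;\frac{1-\operatorname{sgn}(x-y)(-1)^y}{2}\;\operatorname{sgn}(x-y),\qquad \operatorname{sgn}(0)=0,$$ $$A_{i,j}=\sum_{x,y\in\mathbb Z}\Phi_{x,i}\,S_{x,y}\,\Phi_{y,j}\quad(i,j\in I),\qquad [\Phi^tS^t]_{i,x}=\sum_{z\in\mathbb Z}\Phi_{z,i}\,S_{x,z}.$$ These series converge absolutely, $S$ and $A=[A_{i,j}]_{i,j\in I}$ are antisymmetric, and $A$ is invertible. Let $K(x,y)=\begin{pmatrix}K_{1,1}(x,y)&K_{1,2}(x,y)\\K_{2,1}(x,y)&K_{2,2}(x,y)\end{pmatrix}$ with $$\begin{aligned} K_{1,1}(x,y)&=-\sum_{i,j\in I}\Phi_{x,i}\,A^{-1}_{i,j}\,\Phi_{y,j},\\ K_{1,2}(x,y)&=-\sum_{i,j\in I}\Phi_{x,i}\,A^{-1}_{i,j}\,[\Phi^tS^t]_{j,y},\\ K_{2,1}(x,y)&=-\sum_{i,j\in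 I}[\Phi^tS^t]_{i,x}\,A^{-1}_{i,j}\,\Phi_{y,j},\\ K_{2,2}(x,y)&=S_{y,x}-\sum_{i,j\in I}[\Phi^tS^t]_{i,x}\,A^{-1}_{i,j}\,[\Phi^tS^t]_{j,y}. \end{aligned}$$ Then $K_{1,2}(x,y)=-K_{2,1}(y,x)$, and for every $n\in\{0,\dots,2N\}$ and all $x_1,\dots,x_n\in\mathbb Z$, $$\rho^{(n)}(x_1,\dots,x_n)=\operatorname{Pf}\big[K(x_i,x_j)\big]_{i,j=1,\dots,n},$$ where the right-hand side is the Pfaffian of the antisymmetric $2n\times2n$ matrix with $2\times2$ blocks $K(x_i,x_j)$, and $\operatorname{Pf}(M)=\frac1{2^n n!}\sum_{\sigma\in S_{2n}}\operatorname{sgn}(\sigma)\prod_{i=1}^nM_{\sigma(2i-1),\sigma(2i)}$ for an antisymmetric $2n\times 2n$ matrix $M$. -/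

import Mathlib

namespace PNG

open MeasureTheory

noncomputable section

/-- The intensity of the Poisson points. -/
def intensity : ℝ := 2

/-- The rescaled time `√(2ϱ) T`, which is `2T` for the intensity `ϱ = 2`. -/
def Ttilde (T : ℝ) : ℝ := 2 * T

/-- The final time `T√2` of the line ensemble. -/
def finalTime (T : ℝ) : ℝ := Real.sqrt 2 * T

/-- The starting heights of the `2N` lines: the index `j = 0, …, 2N - 1` stands for the
level `-2N + 1 + j`, so that the levels run increasingly through `{-2N + 1, …, 0}`. -/
def level (N : ℕ) (j : Fin (2 * N)) : ℤ := (j : ℤ) - 2 * (N : ℤ) + 1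

/-! ### The symmetric line ensemble with `2N` lines -/

/-- A configuration of `2N` up-jumping lines with `k` jumps in total: the `m`-th jump is a jump
of height one of the line with index `ω.2.1 m`, and it takes place at time `ω.2.2 m`. -/
abbrev LineConfig (N : ℕ) : Type := Σ k : ℕ, (Fin k → Fin (2 * N)) × (Fin k → ℝ)

/-- The height `H_j(s)` at time `s` of the line with index `j`: it starts at its level and is
increased by one at each of its jumps. -/
def height {N : ℕ} (ω : LineConfig N) (j : Fin (2 * N)) (s : ℝ) : ℤ :=
  level N j + ((Finset.univ.filter fun m : Fin ω.1 => ω.2.1 m = j ∧ ω.2.2 m ≤ s).card : ℤ)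

/-- The weight on all configurations of up-jumping lines (intersecting or not):
`√ϱ ^ (number of jumps)` times the uniform (Lebesgue) measure on the jump times
`0 < t₁ < ⋯ < t_k < T√2`, each of the jumps being attributed to any of the lines. -/
def jumpMeasure (N : ℕ) (T : ℝ) : Measure (LineConfig N) :=
  Measure.sum fun k : ℕ =>
    (ENNReal.ofReal (Real.sqrt intensity ^ k) •
      ((Measure.count : Measure (Fin k → Fin (2 * N))).prod
        ((volume : Measure (Fin k → ℝ)).restrict
          {t | StrictMono t ∧ ∀ m, t m ∈ Set.Ioo 0 (finalTime T)}))).map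
      (fun p => (⟨k, p⟩ : LineConfig N))

/-- The allowed line configurations: the lines do not intersect, and the total number of jumps
of each line is even (that all jumps are upwards is built into `LineConfig`). -/
def Allowed (N : ℕ) (T : ℝ) : Set (LineConfig N) :=
  {ω | (∀ s ∈ Set.Icc 0 (finalTime T), StrictMono fun j => height ω j s) ∧
    ∀ j, Even (height ω j (finalTime T) - height ω j 0)}

/-- The law of the symmetric line ensemble with `2N` lines: the above weight, restricted to the
allowed configurations and normalized to total mass one. -/
def lineEnsemble (N : ℕ) (T : ℝ) : Measure (LineConfig N) :=
  ProbabilityTheory.cond (jumpMeasure N T) (Allowed N T)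

/-- The `n`-point correlation function (with respect to counting measure on `ℤ`) of the point
process on `ℤ` formed by the end points `H_j(T√2)` of the `2N` lines:
the sum, over all choices of `n` pairwise distinct lines, of the probability
that the chosen lines end at `x₁, …, xₙ`. -/
def correlation (N : ℕ) (T : ℝ) (n : ℕ) (x : Fin n → ℤ) : ℝ :=
  ∑ f : Fin n ↪ Fin (2 * N),
    (lineEnsemble N T).real {ω | ∀ i, height ω (f i) (finalTime T) = x i}

/-! ### Pfaffians -/

/-- The Pfaffian of an antisymmetric `2n × 2n` matrix. The rows and columns are indexed by
`Fin n × Fin 2` in lexicographic order, so `(i, 0)` and `(i, 1)` are the positions `2i - 1` and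
`2i` when counting from one. The sum is over all permutations `σ`, without constraints such as
`σ(2i-1) < σ(2i)`, and the factor `2ⁿ n!` is the number of times that
each pair partition is counted. -/
def pfaffian {n : ℕ} (M : Matrix (Fin n × Fin 2) (Fin n × Fin 2) ℝ) : ℝ :=
  (∑ σ : Equiv.Perm (Fin n × Fin 2),
    ((Equiv.Perm.sign σ : ℤ) : ℝ) * ∏ i : Fin n, M (σ (i, 0)) (σ (i, 1))) /
    (2 ^ n * (n.factorial : ℝ))

/-- The `2n × 2n` matrix `[K(x_i, x_j)]` whose blocks are the `2 × 2` matrices `K(x_i, x_j)`. -/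
def blockMatrix (K : ℤ → ℤ → Matrix (Fin 2) (Fin 2) ℝ) {n : ℕ} (x : Fin n → ℤ) :
    Matrix (Fin n × Fin 2) (Fin n × Fin 2) ℝ :=
  Matrix.of fun p q => K (x p.1) (x q.1) p.2 q.2

/-! ### The kernel -/

/-- `Φ_{x,i} = T̃^(x-i) / (x-i)!` if `x ≥ i`, and `0` otherwise. -/
def Phi (T : ℝ) (x i : ℤ) : ℝ :=
  if i ≤ x then Ttilde T ^ (x - i).toNat / ((x - i).toNat.factorial : ℝ) else 0

/-- The antisymmetric parity sign matrix `S`. -/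
def S (x y : ℤ) : ℝ :=
  (1 + (Int.sign (x - y) : ℝ) * (-1 : ℝ) ^ x) / 2 *
    ((1 - (Int.sign (x - y) : ℝ) * (-1 : ℝ) ^ y) / 2) * (Int.sign (x - y) : ℝ)

/-- The entry `[Φᵗ S Φ]_{i,j} = ∑_{x,y ∈ ℤ} Φ_{x,i} S_{x,y} Φ_{y,j}`. -/
def PhiSPhi (T : ℝ) (i j : ℤ) : ℝ :=
  ∑' p : ℤ × ℤ, Phi T p.1 i * S p.1 p.2 * Phi T p.2 j

/-- The entry `[Φᵗ Sᵗ]_{i,x} = ∑_{z ∈ ℤ} Φ_{z,i} S_{x,z}`. -/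
def PhiSt (T : ℝ) (i x : ℤ) : ℝ :=
  ∑' z : ℤ, Phi T z i * S x z

/-- The matrix `A = Φᵗ S Φ` with rows and columns in `{-2N + 1, …, 0}`. -/
def A (N : ℕ) (T : ℝ) : Matrix (Fin (2 * N)) (Fin (2 * N)) ℝ :=
  Matrix.of fun i j => PhiSPhi T (level N i) (level N j)

def K11 (N : ℕ) (T : ℝ) (x y : ℤ) : ℝ :=
  -∑ i, ∑ j, Phi T x (level N i) * (A N T)⁻¹ i j * Phi T y (level N j)

def K12 (N : ℕ) (T : ℝ) (x y : ℤ) : ℝ :=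
  -∑ i, ∑ j, Phi T x (level N i) * (A N T)⁻¹ i j * PhiSt T (level N j) y

def K21 (N : ℕ) (T : ℝ) (x y : ℤ) : ℝ :=
  -∑ i, ∑ j, PhiSt T (level N i) x * (A N T)⁻¹ i j * Phi T y (level N j)

def K22 (N : ℕ) (T : ℝ) (x y : ℤ) : ℝ :=
  S y x - ∑ i, ∑ j, PhiSt T (level N i) x * (A N T)⁻¹ i j * PhiSt T (level N j) y

/-- The `2 × 2` matrix kernel. -/
def K (N : ℕ) (T : ℝ) (x y : ℤ) : Matrix (Fin 2) (Fin 2) ℝ :=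
  !![K11 N T x y, K12 N T x y; K21 N T x y, K22 N T x y]

end

end PNG

/-! The correlation functions are read off from a generating functional. A path configuration is a
word, recording which line jumps at each step, together with ordered jump times. The times integrate
to a simplex volume, so the weight of the end points `y` is an exponential generating function of
ordered words. The Karlin–McGregor argument turns it into the determinant of `Φ_{y_b,i}` over
starting levels `i` (`hasSum_wordCount`). For increasing `y`, the Pfaffian of `S` at `y` is a fixed
nonzero constant if every `y_j` has the parity of its starting level, and zero otherwise. It
therefore encodes the evenness constraint (`pfSum_S_alternating`, `pfSum_S_not_alternating`).

De Bruijn's formula then sums determinant times Pfaffian. Up to the same constant, the Pfaffian of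
`Φᵗ c S c Φ`, for a bounded weight `c` on `ℤ`, is the sum over `y` of weight times `∏ c(y_a)`
(`pfSum_weightedA`). With `c = 1` this gives the partition function `Z`; since `Z > 0`, `A` is
invertible.

With `c = 1 + s⁻¹ ∑ 1_{x_a}`, the matrix is a finite-rank perturbation of `A`
(`weightedA_pointWeight`). A Pfaffian Schur complement moves the perturbation from the `2N` line
indices to the `2n` point indices, where it becomes `K + s J` with `J` the symplectic form
(`pfSum_kernelBlocks_perturbed`). Hence `Z · Pf(K + s J)` is the sum over `y` of weight times `sⁿ ∏
c(y_a)`. For distinct `x_i` that product equals `∏_i (s + #{a : y_a = x_i})`, and `s → 0` leaves `Z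
ρ⁽ⁿ⁾`. If two `x_i` coincide, both sides vanish. -/

namespace PNG

open Equiv Equiv.Perm Matrix

/-! ### Unnormalized Pfaffians and congruence. -/

section PfaffianSum

variable {R : Type*} [CommRing R] {ι ι' κ κ' X : Type*} [Fintype ι] [Fintype ι'] [Fintype κ]
  [DecidableEq κ] [Fintype κ'] [DecidableEq κ']

/-- The unnormalized Pfaffian: the signed sum over all permutations of `κ`, where `e` says which
indices are paired. -/
def pfSum (e : ι × Fin 2 ≃ κ) (M : Matrix κ κ R) : R :=
  ∑ σ : Perm κ, ((sign σ : ℤ) : R) * ∏ i, M (σ (e (i, 0))) (σ (e (i, 1)))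

theorem pfSum_reindex (e : ι × Fin 2 ≃ κ) (e' : ι' × Fin 2 ≃ κ') (g : κ ≃ κ') (h : ι ≃ ι')
    (hg : ∀ i b, g (e (i, b)) = e' (h i, b)) (M : Matrix κ' κ' R) :
    pfSum e (M.submatrix g g) = pfSum e' M := by
  unfold pfSum
  refine Fintype.sum_equiv g.permCongr _ _ fun σ => ?_
  rw [sign_permCongr]
  congr 1
  refine Fintype.prod_equiv h _ _ fun i => ?_
  simp [← hg]

theorem pfSum_eq_zero_of_invariant_swap (e : ι × Fin 2 ≃ κ) (M : Matrix κ κ ℝ) {p q : κ}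
    (hpq : p ≠ q) (hM : M.submatrix (swap p q) (swap p q) = M) : pfSum e M = 0 := by
  have h : pfSum e M = -pfSum e M := by
    conv_lhs => rw [pfSum, ← Equiv.sum_comp (Equiv.mulLeft (swap p q))]
    rw [pfSum, ← Finset.sum_neg_distrib]
    refine Finset.sum_congr rfl fun σ _ => ?_
    have : ∀ a b, M (swap p q a) (swap p q b) = M a b := fun a b => congrFun (congrFun hM a) b
    simp [sign_swap hpq, this]
  linarith

theorem pfSum_eq_zero_of_row (e : ι × Fin 2 ≃ κ) (M : Matrix κ κ R) (p : κ)
    (hr : ∀ q, M p q = 0) (hc : ∀ q, M q p = 0) : pfSum e M = 0 := by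
  refine Finset.sum_eq_zero fun σ _ => ?_
  obtain ⟨⟨i, b⟩, hi⟩ := e.surjective (σ.symm p)
  have hp : σ (e (i, b)) = p := by rw [hi]; simp
  rw [Finset.prod_eq_zero (Finset.mem_univ i), mul_zero]
  fin_cases b
  · simp only [Fin.zero_eta] at hp; rw [hp, hr]
  · simp only [Fin.mk_one] at hp; rw [hp, hc]

theorem pfSum_smul (e : ι × Fin 2 ≃ κ) (c : R) (M : Matrix κ κ R) :
    pfSum e (c • M) = c ^ Fintype.card ι * pfSum e M := by
  unfold pfSum
  rw [Finset.mul_sum]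
  refine Finset.sum_congr rfl fun σ _ => ?_
  simp only [Matrix.smul_apply, smul_eq_mul, Finset.prod_mul_distrib, Finset.prod_const,
    Finset.card_univ]
  ring

/-- The expansion of the Pfaffian of `B M Bᵀ` with a rectangular matrix `B`. -/
theorem pfSum_congruence_expand [DecidableEq ι] (e : ι × Fin 2 ≃ κ) (B : κ → X → R)
    (M : X → X → R) (s : Finset X) :
    pfSum e (of fun a b => ∑ p ∈ s, ∑ q ∈ s, B a p * M p q * B b q) =
      ∑ f ∈ Fintype.piFinset fun _ : κ => s,
        (∏ i, M (f (e (i, 0))) (f (e (i, 1)))) * (of fun a b => B a (f b)).det := by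
  classical
  -- Distributivity: choosing one pair of points for each `i` is the same, through `e`, as choosing
  -- one point for each element of `κ`.
  have key : ∀ F : ι → X → X → R, ∏ i, ∑ p ∈ s, ∑ q ∈ s, F i p q =
      ∑ f ∈ Fintype.piFinset fun _ : κ => s, ∏ i, F i (f (e (i, 0))) (f (e (i, 1))) := by
    intro F
    simp_rw [← Finset.sum_product' s s]
    rw [Finset.prod_univ_sum]
    symm
    refine Finset.sum_equiv ((e.symm.arrowCongr (Equiv.refl X)).trans
      ((Equiv.curry ι (Fin 2) X).trans (Equiv.arrowCongr (Equiv.refl ι) (finTwoArrowEquiv X))))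
      ?_ ?_
    · intro f
      simp only [Fintype.mem_piFinset, Finset.mem_product]
      constructor
      · intro h i; exact ⟨h _, h _⟩
      · intro h a
        obtain ⟨⟨i, b⟩, rfl⟩ := e.surjective a
        fin_cases b
        · exact (h i).1
        · exact (h i).2
    · intro f _
      rfl
  have hdet : ∀ (f : κ → X) , (of fun a b => B a (f b)).det =
      ∑ σ : Perm κ, ((sign σ : ℤ) : R) *
        ∏ i, B (σ (e (i, 0))) (f (e (i, 0))) * B (σ (e (i, 1))) (f (e (i, 1))) := by
    intro f
    rw [det_apply']
    refine Finset.sum_congr rfl fun σ _ => ?_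
    congr 1
    rw [← e.prod_comp, Fintype.prod_prod_type]
    simp
  simp only [pfSum, of_apply]
  simp_rw [key, hdet, Finset.mul_sum]
  rw [Finset.sum_comm]
  refine Finset.sum_congr rfl fun f _ => Finset.sum_congr rfl fun σ _ => ?_
  rw [mul_left_comm, ← Finset.prod_mul_distrib]
  congr 1
  exact Finset.prod_congr rfl fun i _ => by ring

/-- In the expansion over `f : κ → κ`, a non-injective `f` repeats a column of `B`. A permutation
contributes its sign times `det B`, and these terms reassemble into the Pfaffian of `M`. -/
theorem pfSum_congruence [DecidableEq ι] (e : ι × Fin 2 ≃ κ) (B M : Matrix κ κ R) :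
    pfSum e (B * M * Bᵀ) = B.det * pfSum e M := by
  have h := pfSum_congruence_expand e B M Finset.univ
  have h1 : (of fun a b => ∑ p, ∑ q, B a p * M p q * B b q) = B * M * Bᵀ := by
    ext a b
    simp only [of_apply, Matrix.mul_apply, transpose_apply, Finset.sum_mul]
    rw [Finset.sum_comm]
  rw [h1] at h
  rw [h, Fintype.piFinset_univ, pfSum, Finset.mul_sum]
  rw [← Finset.sum_subset (Finset.subset_univ
    (Finset.univ.filter fun f : κ → κ => Function.Bijective f))]
  · symm
    refine Finset.sum_bij (fun σ _ => (σ : κ → κ)) (fun σ _ => by simp)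
      (fun σ _ τ _ h => DFunLike.coe_injective h)
      (fun f hf => ⟨Equiv.ofBijective f (Finset.mem_filter.1 hf).2, by simp, rfl⟩) fun σ _ => ?_
    have : (of fun a b => B a (σ b)) = B.submatrix id σ := rfl
    rw [this, det_permute']
    ring
  · intro f _ hf
    have hf' : ¬Function.Injective f := fun h => hf (by
      simpa using (Finite.injective_iff_bijective.1 h))
    simp only [Function.Injective, not_forall] at hf'
    obtain ⟨a, b, hab, hne⟩ := hf'
    rw [det_zero_of_column_eq hne (fun k => by simp [hab]), mul_zero]

/-- Relabelling `f` by each permutation `σ` costs `sign σ` in the determinant. Adding up all `σ`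
completes the product of entries of `M` to a full Pfaffian. The summand is then symmetric in the
values of `f`, which permits sorting. -/
theorem pfSum_congruence_symmetrized [DecidableEq ι] (e : ι × Fin 2 ≃ κ) (B : κ → X → R)
    (M : X → X → R) (s : Finset X) :
    ((Fintype.card κ).factorial : R) *
        pfSum e (of fun a b => ∑ p ∈ s, ∑ q ∈ s, B a p * M p q * B b q) =
      ∑ f ∈ Fintype.piFinset fun _ : κ => s,
        (of fun a b => B a (f b)).det * pfSum e (of fun a b => M (f a) (f b)) := by
  classical
  have h : ∀ σ : Perm κ, pfSum e (of fun a b => ∑ p ∈ s, ∑ q ∈ s, B a p * M p q * B b q) =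
      ∑ f ∈ Fintype.piFinset fun _ : κ => s,
        (∏ i, M (f (σ (e (i, 0)))) (f (σ (e (i, 1))))) *
          (((sign σ : ℤ) : R) * (of fun a b => B a (f b)).det) := by
    intro σ
    rw [pfSum_congruence_expand]
    refine Finset.sum_equiv (σ.arrowCongr (Equiv.refl X)) ?_ ?_
    · intro f
      simp only [Fintype.mem_piFinset, arrowCongr_apply, Function.comp, Equiv.refl_apply]
      exact ⟨fun h a => h _, fun h a => by simpa using h (σ a)⟩
    · intro f _
      simp only [arrowCongr_apply, Function.comp, Equiv.refl_apply, symm_apply_apply]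
      congr 1
      have : (of fun a b => B a (f (σ.symm b))) = (of fun a b => B a (f b)).submatrix id σ.symm :=
        rfl
      rw [this, det_permute', sign_symm, ← mul_assoc, ← Int.cast_mul, ← Units.val_mul,
        Int.units_mul_self]
      simp
  rw [← Fintype.card_perm, ← nsmul_eq_mul, ← Finset.card_univ, ← Finset.sum_const]
  rw [Finset.sum_congr rfl fun σ _ => h σ, Finset.sum_comm]
  refine Finset.sum_congr rfl fun f _ => ?_
  rw [pfSum, Finset.mul_sum]
  exact Finset.sum_congr rfl fun σ _ => by simp only [of_apply]; ring

/-- A left kernel vector `v` with `v p ≠ 0`, inserted as row `p` of the identity, gives a congruence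
of determinant `v p` that annihilates row `p` of `M`, and column `p` by antisymmetry. So `v p` times
the Pfaffian is zero. -/
theorem det_ne_zero_of_pfSum_ne_zero {F : Type*} [Field F] [DecidableEq ι] (e : ι × Fin 2 ≃ κ)
    (M : Matrix κ κ F)
    (hM : Mᵀ = -M) (h : pfSum e M ≠ 0) : M.det ≠ 0 := by
  intro hdet
  obtain ⟨v, hv, hvM⟩ := exists_vecMul_eq_zero_iff.2 hdet
  obtain ⟨p, hp⟩ := Function.ne_iff.1 hv
  have hB := pfSum_congruence e (updateRow 1 p v) M
  have hrow : ∀ q, (updateRow 1 p v * M * (updateRow 1 p v)ᵀ) p q = 0 := by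
    intro q
    have : ∀ r, (updateRow 1 p v * M) p r = 0 := by
      intro r
      simpa [Matrix.mul_apply, vecMul, dotProduct] using congrFun hvM r
    rw [Matrix.mul_apply]
    simp [this]
  have hanti : (updateRow 1 p v * M * (updateRow 1 p v)ᵀ)ᵀ =
      -(updateRow 1 p v * M * (updateRow 1 p v)ᵀ) := by
    simp [Matrix.transpose_mul, hM, Matrix.mul_assoc]
  have hcol : ∀ q, (updateRow 1 p v * M * (updateRow 1 p v)ᵀ) q p = 0 := by
    intro q
    have := congrFun (congrFun hanti p) q
    rw [transpose_apply] at this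
    rw [this, Matrix.neg_apply, hrow, neg_zero]
  rw [pfSum_eq_zero_of_row e _ p hrow hcol] at hB
  have hd : (updateRow (1 : Matrix κ κ F) p v).det = v p := by
    have := det_updateRow_sum (1 : Matrix κ κ F) p v
    rw [← vecMul_one v]
    have h2 : (v ᵥ* (1 : Matrix κ κ F)) = ∑ k, v k • (1 : Matrix κ κ F) k := by
      rw [vecMul_eq_sum]
    rw [h2, this]
    simp [Matrix.one_apply]
  rw [hd] at hB
  exact (mul_ne_zero hp h) hB.symm

end PfaffianSum

end PNG

namespace PNG

open Equiv Equiv.Perm Matrix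

/-! ### Block matrices, the symplectic form and the Schur complement. -/

section PfaffianBlocks

section

variable {ι ι' κ κ' : Type*}

/-- The pairing of a disjoint union. -/
def sumPairing (e : ι × Fin 2 ≃ κ) (e' : ι' × Fin 2 ≃ κ') : (ι ⊕ ι') × Fin 2 ≃ κ ⊕ κ' :=
  (sumProdDistrib ι ι' (Fin 2)).trans (sumCongr e e')

@[simp] theorem sumPairing_inl (e : ι × Fin 2 ≃ κ) (e' : ι' × Fin 2 ≃ κ') (i : ι) (b : Fin 2) :
    sumPairing e e' (Sum.inl i, b) = Sum.inl (e (i, b)) := rfl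

@[simp] theorem sumPairing_inr (e : ι × Fin 2 ≃ κ) (e' : ι' × Fin 2 ≃ κ') (i : ι') (b : Fin 2) :
    sumPairing e e' (Sum.inr i, b) = Sum.inr (e' (i, b)) := rfl

/-- The permutation that moves the pairs by `π`. -/
def pairPerm (e : ι × Fin 2 ≃ κ) (π : Perm ι) : Perm κ :=
  e.permCongr (prodCongrLeft fun _ : Fin 2 => π)

theorem pairPerm_apply (e : ι × Fin 2 ≃ κ) (π : Perm ι) (i : ι) (b : Fin 2) :
    pairPerm e π (e (i, b)) = e (π i, b) := by
  simp [pairPerm]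

/-- The pairing of two copies of an index type. -/
def doublePairing (ι : Type*) : ι × Fin 2 ≃ ι ⊕ ι :=
  ((Equiv.refl ι).prodCongr finTwoEquiv).trans ((prodComm ι Bool).trans (boolProdEquivSum ι))

@[simp] theorem doublePairing_zero (i : ι) : doublePairing ι (i, 0) = Sum.inl i := rfl
@[simp] theorem doublePairing_one (i : ι) : doublePairing ι (i, 1) = Sum.inr i := rfl

end

variable {R : Type*} [CommRing R] {ι ι' κ κ' : Type*} [Fintype ι] [Fintype ι'] [Fintype κ]
  [DecidableEq κ] [Fintype κ'] [DecidableEq κ']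

/-- Only permutations preserving both summands contribute; any other sends some left index to the
right, where the padded `V` is zero. -/
theorem sum_blocks_standard (e : ι × Fin 2 ≃ κ) (e' : ι' × Fin 2 ≃ κ') (V : Matrix κ κ R)
    (W : Matrix κ' κ' R) :
    (∑ σ : Perm (κ ⊕ κ'), ((sign σ : ℤ) : R) *
      ((∏ i : ι, fromBlocks V 0 0 (0 : Matrix κ' κ' R) (σ (Sum.inl (e (i, 0))))
          (σ (Sum.inl (e (i, 1))))) *
        ∏ i : ι', fromBlocks (0 : Matrix κ κ R) 0 0 W (σ (Sum.inr (e' (i, 0))))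
          (σ (Sum.inr (e' (i, 1)))))) = pfSum e V * pfSum e' W := by
  classical
  symm
  convert!
    (Finset.sum_subset (M := R) (Finset.subset_univ
      ((sumCongrHom κ κ').range : Set (Perm (κ ⊕ κ'))).toFinset) ?_)
  · unfold pfSum
    simp_rw [Finset.sum_mul_sum, ← Finset.sum_product', Finset.univ_product_univ]
    refine Finset.sum_nbij (fun σ ↦ σ.fst.sumCongr σ.snd) ?_ ?_ ?_ ?_
    · intro σ₁₂ _
      exact Set.mem_toFinset.2 ⟨σ₁₂, rfl⟩
    · intro σ₁ _ σ₂ _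
      dsimp only
      intro h
      have h2 : ∀ x, Perm.sumCongr σ₁.fst σ₁.snd x = Perm.sumCongr σ₂.fst σ₂.snd x :=
        DFunLike.congr_fun h
      simp only [Sum.map_inr, Sum.map_inl, Perm.sumCongr_apply, Sum.forall, Sum.inl.injEq,
        Sum.inr.injEq] at h2
      ext x
      · exact h2.left x
      · exact h2.right x
    · intro σ hσ
      rw [Finset.mem_coe, Set.mem_toFinset] at hσ
      obtain ⟨σ₁₂, hσ₁₂⟩ := hσ
      use σ₁₂
      rw [← hσ₁₂]
      simp
    · rintro ⟨σ₁, σ₂⟩ -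
      simp only [Perm.sumCongr_apply, Sum.map_inr, Sum.map_inl, fromBlocks_apply₁₁,
        fromBlocks_apply₂₂, sign_sumCongr, Units.val_mul, Int.cast_mul]
      ring
  · rintro σ - hσn
    have h1 : ¬∀ x, ∃ y, Sum.inl y = σ (Sum.inl x) := by
      rw [Set.mem_toFinset] at hσn
      simpa only [Set.MapsTo, Set.mem_range, forall_exists_index, forall_apply_eq_imp_iff] using
        mt mem_sumCongrHom_range_of_perm_mapsTo_inl hσn
    obtain ⟨a, ha⟩ := not_forall.mp h1
    obtain ⟨⟨i, b⟩, rfl⟩ := e.surjective a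
    rcases hx : σ (Sum.inl (e (i, b))) with a2 | c
    · exact absurd hx.symm ((not_exists.mp ha) a2)
    · rw [Finset.prod_eq_zero (Finset.mem_univ i), zero_mul, mul_zero]
      fin_cases b
      · simp only [Fin.zero_eta] at hx
        rw [hx]
        rcases σ (Sum.inl (e (i, 1))) with _ | _ <;> simp
      · simp only [Fin.mk_one] at hx
        rw [hx]
        rcases σ (Sum.inl (e (i, 0))) with _ | _ <;> simp

variable [DecidableEq ι] [DecidableEq ι']

theorem sign_pairPerm (e : ι × Fin 2 ≃ κ) (π : Perm ι) : sign (pairPerm e π) = 1 := by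
  rw [pairPerm, sign_permCongr, sign_prodCongrLeft]
  simp

/-- The binomial coefficient is the price of omitting the normalization: it counts the sets `t` of
pairs that are sent into the block `V`. All choices contribute equally, since moving whole pairs is
an even permutation. -/
theorem pfSum_fromBlocks_diag (e : ι × Fin 2 ≃ κ) (e' : ι' × Fin 2 ≃ κ') (V : Matrix κ κ R)
    (W : Matrix κ' κ' R) :
    pfSum (sumPairing e e') (fromBlocks V 0 0 W) =
      ((Fintype.card ι + Fintype.card ι').choose (Fintype.card ι) : R) *
        (pfSum e V * pfSum e' W) := by
  classical
  set E := sumPairing e e' with hE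
  set P : κ ⊕ κ' → κ ⊕ κ' → R := fromBlocks V 0 0 (0 : Matrix κ' κ' R) with hP
  set Q : κ ⊕ κ' → κ ⊕ κ' → R := fromBlocks (0 : Matrix κ κ R) 0 0 W with hQ
  have hPQ : ∀ a b, fromBlocks V 0 0 W a b = P a b + Q a b := by
    intro a b
    rcases a with a | a <;> rcases b with b | b <;> simp [hP, hQ]
  have hP0 : ∀ a b, P a b ≠ 0 → a.isLeft ∧ b.isLeft := by
    intro a b
    rcases a with a | a <;> rcases b with b | b <;> simp [hP]
  have hQ0 : ∀ a b, Q a b ≠ 0 → a.isRight ∧ b.isRight := by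
    intro a b
    rcases a with a | a <;> rcases b with b | b <;> simp [hQ]
  let F : Finset (ι ⊕ ι') → R := fun t => ∑ σ : Perm (κ ⊕ κ'), ((sign σ : ℤ) : R) *
    ((∏ i ∈ t, P (σ (E (i, 0))) (σ (E (i, 1)))) * ∏ i ∈ tᶜ, Q (σ (E (i, 0))) (σ (E (i, 1))))
  have hsum : pfSum E (fromBlocks V 0 0 W) = ∑ t, F t := by
    simp only [pfSum, hPQ, F]
    rw [Finset.sum_comm]
    refine Finset.sum_congr rfl fun σ _ => ?_
    rw [Finset.prod_add, Finset.mul_sum, Finset.powerset_univ]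
    refine Finset.sum_congr rfl fun t _ => ?_
    rw [Finset.compl_eq_univ_sdiff]
  have hcardκ : Fintype.card κ = 2 * Fintype.card ι := by
    rw [← Fintype.card_congr e]; simp [mul_comm]
  -- A nonzero term makes `σ` a bijection from the elements of the pairs in `t` onto `κ`, which
  -- fixes the size of `t`.
  have hzero : ∀ t : Finset (ι ⊕ ι'), t.card ≠ Fintype.card ι → F t = 0 := by
    intro t ht
    refine Finset.sum_eq_zero fun σ _ => ?_
    by_contra hne
    have h1 : ∀ i ∈ t, P (σ (E (i, 0))) (σ (E (i, 1))) ≠ 0 := by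
      intro i hi h0
      exact hne (by rw [Finset.prod_eq_zero hi h0]; simp)
    have h2 : ∀ i ∈ tᶜ, Q (σ (E (i, 0))) (σ (E (i, 1))) ≠ 0 := by
      intro i hi h0
      exact hne (by rw [Finset.prod_eq_zero hi h0]; simp)
    have h3 : ∀ i b, (σ (E (i, b))).isLeft ↔ i ∈ t := by
      intro i b
      by_cases hi : i ∈ t
      · have := hP0 _ _ (h1 i hi)
        fin_cases b <;> simp [hi, this.1, this.2]
      · have := hQ0 _ _ (h2 i (by simpa using hi))
        fin_cases b <;> simp [hi, this.1, this.2, ← Sum.not_isRight]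
    have h4 : (t ×ˢ (Finset.univ : Finset (Fin 2))).card =
        (Finset.univ.filter fun a : κ ⊕ κ' => a.isLeft).card := by
      refine Finset.card_equiv (E.trans σ) ?_
      rintro ⟨i, b⟩
      simp [h3]
    have h5 : (Finset.univ.filter fun a : κ ⊕ κ' => a.isLeft).card = Fintype.card κ := by
      rw [← Finset.card_univ,
        ← Finset.card_map (s := (Finset.univ : Finset κ)) (Function.Embedding.inl (β := κ'))]
      congr 1
      ext a
      rcases a with a | a <;> simp
    rw [Finset.card_product, Finset.card_univ, Fintype.card_fin, h5, hcardκ] at h4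
    omega
  have hconst : ∀ t : Finset (ι ⊕ ι'), t.card = Fintype.card ι → F t = pfSum e V * pfSum e' W := by
    intro t ht
    obtain ⟨π, hπ⟩ : ∃ π : Perm (ι ⊕ ι'), ∀ i, π i ∈ t ↔ i.isLeft := by
      have c1 : Fintype.card {i : ι ⊕ ι' // i.isLeft} = Fintype.card {i // i ∈ t} := by
        rw [Fintype.card_coe, ht, Fintype.card_subtype, ← Finset.card_univ,
          ← Finset.card_map (s := (Finset.univ : Finset ι)) (Function.Embedding.inl (β := ι'))]
        congr 1
        ext a
        rcases a with a | a <;> simp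
      let f := Fintype.equivOfCardEq c1
      refine ⟨f.extendSubtype, fun i => ?_⟩
      by_cases hi : i.isLeft = true
      · simpa [hi] using f.extendSubtype_mem i hi
      · simpa [hi] using f.extendSubtype_not_mem i hi
    have hm1 : ∀ g : ι ⊕ ι' → R, ∏ i ∈ t, g i = ∏ i : ι, g (π (Sum.inl i)) := by
      intro g
      refine Eq.trans ?_ (Finset.prod_map Finset.univ Function.Embedding.inl fun i => g (π i))
      symm
      refine Finset.prod_equiv π ?_ (fun _ _ => rfl)
      intro i
      rw [hπ]
      rcases i with i | i <;> simp
    have hm2 : ∀ g : ι ⊕ ι' → R, ∏ i ∈ tᶜ, g i = ∏ i : ι', g (π (Sum.inr i)) := by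
      intro g
      refine Eq.trans ?_ (Finset.prod_map Finset.univ Function.Embedding.inr fun i => g (π i))
      symm
      refine Finset.prod_equiv π ?_ (fun _ _ => rfl)
      intro i
      rw [Finset.mem_compl, hπ]
      rcases i with i | i <;> simp
    rw [← sum_blocks_standard e e' V W]
    refine Fintype.sum_equiv (Equiv.mulRight (pairPerm E π)) _ _ fun σ => ?_
    simp only [coe_mulRight, Perm.sign_mul, sign_pairPerm, mul_one, Perm.mul_apply, hm1, hm2]
    simp only [← sumPairing_inl e e', ← sumPairing_inr e e', ← hE, pairPerm_apply]
    rfl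
  rw [hsum, ← Finset.sum_subset (Finset.subset_univ (Finset.powersetCard (Fintype.card ι)
    (Finset.univ : Finset (ι ⊕ ι'))))]
  · rw [Finset.sum_congr rfl fun t ht => hconst t (Finset.mem_powersetCard.1 ht).2,
      Finset.sum_const, Finset.card_powersetCard, Finset.card_univ, Fintype.card_sum, nsmul_eq_mul]
  · intro t _ ht
    exact hzero t fun h => ht (by simp [h])

theorem pfSum_standard_unit :
    pfSum (doublePairing Unit) (fromBlocks (0 : Matrix Unit Unit R) 1 (-1) 0) = 2 := by
  have h : (Finset.univ : Finset (Perm (Unit ⊕ Unit))) =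
      {1, swap (Sum.inl ()) (Sum.inr ())} := by decide
  rw [pfSum, h, Finset.sum_pair (by decide)]
  simp
  norm_num

theorem pfSum_standard (n : ℕ) :
    pfSum (doublePairing (Fin n)) (fromBlocks (0 : Matrix (Fin n) (Fin n) R) 1 (-1) 0) =
      2 ^ n * (n.factorial : R) := by
  induction n with
  | zero => simp [pfSum]
  | succ n ih =>
    have hb := pfSum_fromBlocks_diag (doublePairing (Fin n)) (doublePairing Unit)
      (fromBlocks (0 : Matrix (Fin n) (Fin n) R) 1 (-1) 0)
      (fromBlocks (0 : Matrix Unit Unit R) 1 (-1) 0)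
    rw [ih, pfSum_standard_unit] at hb
    let h : Fin n ⊕ Unit ≃ Fin (n + 1) :=
      (sumCongr (Equiv.refl _) (Equiv.ofUnique Unit (Fin 1))).trans finSumFinEquiv
    let g := (sumPairing (doublePairing (Fin n)) (doublePairing Unit)).symm.trans
      ((h.prodCongr (Equiv.refl (Fin 2))).trans (doublePairing (Fin (n + 1))))
    have hr := pfSum_reindex (sumPairing (doublePairing (Fin n)) (doublePairing Unit))
      (doublePairing (Fin (n + 1))) g h (fun i b => by simp [g])
      (fromBlocks (0 : Matrix (Fin (n + 1)) (Fin (n + 1)) R) 1 (-1) 0)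
    have hg : ∀ i b, g (sumPairing (doublePairing (Fin n)) (doublePairing Unit) (i, b)) =
      doublePairing (Fin (n + 1)) (h i, b) := fun i b => by simp [g]
    have hM : (fromBlocks (0 : Matrix (Fin (n + 1)) (Fin (n + 1)) R) 1 (-1) 0).submatrix g g =
        fromBlocks (fromBlocks (0 : Matrix (Fin n) (Fin n) R) 1 (-1) 0) 0 0
          (fromBlocks (0 : Matrix Unit Unit R) 1 (-1) 0) := by
      have h00 : ∀ i, g (Sum.inl (Sum.inl i)) = Sum.inl (h (Sum.inl i)) := fun i =>
        hg (Sum.inl i) 0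
      have h01 : ∀ i, g (Sum.inl (Sum.inr i)) = Sum.inr (h (Sum.inl i)) := fun i =>
        hg (Sum.inl i) 1
      have h10 : ∀ i, g (Sum.inr (Sum.inl i)) = Sum.inl (h (Sum.inr i)) := fun i =>
        hg (Sum.inr i) 0
      have h11 : ∀ i, g (Sum.inr (Sum.inr i)) = Sum.inr (h (Sum.inr i)) := fun i =>
        hg (Sum.inr i) 1
      ext a b
      rcases a with (a | a) | (a | a) <;> rcases b with (b | b) | (b | b) <;>
        simp [h00, h01, h10, h11, Matrix.one_apply]
    rw [← hr, hM, hb, Nat.factorial_succ]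
    simp
    ring

/-- The matrix is the congruence of the standard symplectic form by `diag(P, 1)`. -/
theorem pfSum_fromBlocks_zero_diag (n : ℕ) (P : Matrix (Fin n) (Fin n) R) :
    pfSum (doublePairing (Fin n)) (fromBlocks 0 P (-Pᵀ) 0) = 2 ^ n * (n.factorial : R) * P.det := by
  have h := pfSum_congruence (doublePairing (Fin n)) (fromBlocks P 0 0 1)
    (fromBlocks (0 : Matrix (Fin n) (Fin n) R) 1 (-1) 0)
  rw [pfSum_standard] at h
  have h2 : fromBlocks P 0 0 1 * fromBlocks (0 : Matrix (Fin n) (Fin n) R) 1 (-1) 0 *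
      (fromBlocks P 0 0 1)ᵀ = fromBlocks 0 P (-Pᵀ) 0 := by
    simp [fromBlocks_transpose, fromBlocks_multiply]
  rw [← h2, h]
  simp
  ring

/-- Eliminate the off-diagonal blocks of `[[V, C], [-Cᵀ, A]]` once with `A⁻¹` and once with `V⁻¹`.
Both eliminations are unipotent congruences, so both results have the same Pfaffian. The binomial
factor stays because `R` is an arbitrary commutative ring. -/
theorem pfSum_schur_complement (e : ι × Fin 2 ≃ κ) (e' : ι' × Fin 2 ≃ κ') (V V' : Matrix κ κ R)
    (A A' : Matrix κ' κ' R) (C : Matrix κ κ' R) (hV : Vᵀ = -V) (hA : Aᵀ = -A)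
    (hV' : V * V' = 1) (hA' : A * A' = 1) :
    ((Fintype.card ι + Fintype.card ι').choose (Fintype.card ι) : R) *
        (pfSum e (V + C * A' * Cᵀ) * pfSum e' A) =
      ((Fintype.card ι + Fintype.card ι').choose (Fintype.card ι) : R) *
        (pfSum e V * pfSum e' (A + Cᵀ * V' * C)) := by
  have hV2 : V' * V = 1 := mul_eq_one_comm.1 hV'
  have hA2 : A' * A = 1 := mul_eq_one_comm.1 hA'
  have hVt : V'ᵀ = -V' := by
    have h1 : V'ᵀ * Vᵀ = 1 := by rw [← transpose_mul, hV', transpose_one]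
    calc V'ᵀ = V'ᵀ * (V * V') := by rw [hV', Matrix.mul_one]
      _ = -(V'ᵀ * Vᵀ) * V' := by rw [hV]; simp [Matrix.mul_assoc]
      _ = -V' := by rw [h1]; simp
  have hAt : A'ᵀ = -A' := by
    have h1 : A'ᵀ * Aᵀ = 1 := by rw [← transpose_mul, hA', transpose_one]
    calc A'ᵀ = A'ᵀ * (A * A') := by rw [hA', Matrix.mul_one]
      _ = -(A'ᵀ * Aᵀ) * A' := by rw [hA]; simp [Matrix.mul_assoc]
      _ = -A' := by rw [h1]; simp
  have h1 := pfSum_congruence (sumPairing e e') (fromBlocks 1 (-(C * A')) 0 1)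
    (fromBlocks V C (-Cᵀ) A)
  have h2 := pfSum_congruence (sumPairing e e') (fromBlocks 1 0 (Cᵀ * V') 1)
    (fromBlocks V C (-Cᵀ) A)
  have e1 : fromBlocks 1 (-(C * A')) 0 1 * fromBlocks V C (-Cᵀ) A *
      (fromBlocks 1 (-(C * A')) 0 1)ᵀ = fromBlocks (V + C * A' * Cᵀ) 0 0 A := by
    simp [fromBlocks_transpose, fromBlocks_multiply, Matrix.mul_assoc, hA2, hAt]
    rw [← Matrix.mul_assoc A, hA']
    simp
  have e2 : fromBlocks 1 0 (Cᵀ * V') 1 * fromBlocks V C (-Cᵀ) A *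
      (fromBlocks 1 0 (Cᵀ * V') 1)ᵀ = fromBlocks V 0 0 (A + Cᵀ * V' * C) := by
    simp [fromBlocks_transpose, fromBlocks_multiply, Matrix.mul_assoc, hV2, hVt]
    rw [← Matrix.mul_assoc V, hV', add_comm]
    simp [add_comm]
  rw [e1, det_fromBlocks_zero₂₁, pfSum_fromBlocks_diag] at h1
  rw [e2, det_fromBlocks_zero₁₂, pfSum_fromBlocks_diag] at h2
  rw [h1, h2]

end PfaffianBlocks

end PNG

/-! ### De Bruijn's formula and the Pfaffian of the parity sign matrix. -/

namespace PNG

open Equiv Equiv.Perm Matrix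

theorem pfSum_submatrix_perm {ι κ R : Type*} [CommRing R] [Fintype ι] [Fintype κ] [DecidableEq κ]
    (e : ι × Fin 2 ≃ κ) (M : Matrix κ κ R) (τ : Perm κ) :
    pfSum e (M.submatrix τ τ) = ((sign τ : ℤ) : R) * pfSum e M := by
  conv_rhs => rw [pfSum, ← Equiv.sum_comp (Equiv.mulLeft τ)]
  rw [pfSum, Finset.mul_sum]
  refine Finset.sum_congr rfl fun σ _ => ?_
  have h : ((sign τ : ℤ) : R) * ((sign τ : ℤ) : R) = 1 := by
    rw [← Int.cast_mul, ← Units.val_mul, Int.units_mul_self]; simp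
  simp only [coe_mulLeft, Perm.sign_mul, Perm.mul_apply, submatrix_apply, Units.val_mul,
    Int.cast_mul, ← mul_assoc, h, one_mul]

theorem pfSum_eq_zero_of_rows_eq {ι κ : Type*} [Fintype ι] [Fintype κ] [DecidableEq κ]
    (e : ι × Fin 2 ≃ κ) (M : Matrix κ κ ℝ) {p q : κ} (hpq : p ≠ q) (hr : ∀ r, M p r = M q r)
    (hc : ∀ r, M r p = M r q) : pfSum e M = 0 := by
  refine pfSum_eq_zero_of_invariant_swap e M hpq ?_
  have h1 : ∀ a r, M (swap p q a) r = M a r := by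
    intro a r
    rw [swap_apply_def]
    split_ifs with ha hb
    · rw [ha, hr]
    · rw [hb, hr]
    · rfl
  have h2 : ∀ a r, M r (swap p q a) = M r a := by
    intro a r
    rw [swap_apply_def]
    split_ifs with ha hb
    · rw [ha, hc]
    · rw [hb, hc]
    · rfl
  ext a b
  rw [submatrix_apply, h1, h2]

open scoped Classical in
-- Every injective tuple is an increasing tuple composed with a unique permutation.
theorem sum_piFinset_eq_sum_strictMono (m : ℕ) (s : Finset ℤ) (G : (Fin m → ℤ) → ℝ)
    (hperm : ∀ (f : Fin m → ℤ) (σ : Perm (Fin m)), G (f ∘ σ) = G f)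
    (h0 : ∀ f, ¬Function.Injective f → G f = 0) :
    ∑ f ∈ Fintype.piFinset fun _ : Fin m => s, G f =
      m.factorial * ∑ y ∈ (Fintype.piFinset fun _ : Fin m => s).filter StrictMono, G y := by
  have hR : (m.factorial : ℝ) * ∑ y ∈ (Fintype.piFinset fun _ : Fin m => s).filter StrictMono, G y =
      ∑ p ∈ (Finset.univ : Finset (Perm (Fin m))) ×ˢ
        (Fintype.piFinset fun _ : Fin m => s).filter StrictMono, G (p.2 ∘ p.1) := by
    rw [Finset.sum_product]
    simp only [hperm, Finset.sum_const, Finset.card_univ, Fintype.card_perm, Fintype.card_fin,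
      nsmul_eq_mul]
  rw [hR, ← Finset.sum_subset (Finset.filter_subset Function.Injective _)]
  · symm
    refine Finset.sum_bij (fun p _ => p.2 ∘ p.1) ?_ ?_ ?_ (fun _ _ => rfl)
    · rintro ⟨σ, y⟩ h
      simp only [Finset.mem_product, Finset.mem_univ, true_and, Finset.mem_filter,
        Fintype.mem_piFinset] at h ⊢
      exact ⟨fun a => h.1 _, h.2.injective.comp σ.injective⟩
    · rintro ⟨σ, y⟩ h ⟨σ', y'⟩ h' heq
      simp only [Finset.mem_product, Finset.mem_univ, true_and, Finset.mem_filter] at h h' heq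
      have hy : y = y' := by
        apply (StrictMono.range_inj h.2 h'.2).1
        rw [← σ.surjective.range_comp y, heq, σ'.surjective.range_comp]
      subst hy
      have : σ = σ' := by
        ext a
        exact congrArg _ (h.2.injective (congrFun heq a))
      rw [this]
    · intro f hf
      simp only [Finset.mem_filter, Fintype.mem_piFinset] at hf
      refine ⟨((Tuple.sort f)⁻¹, f ∘ Tuple.sort f), ?_, ?_⟩
      · simp only [Finset.mem_product, Finset.mem_univ, true_and, Finset.mem_filter,
          Fintype.mem_piFinset]
        exact ⟨fun a => hf.1 _, (Tuple.monotone_sort f).strictMono_of_injective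
          (hf.2.comp (Tuple.sort f).injective)⟩
      · ext a; simp
  · intro f hf hf'
    exact h0 f fun h => hf' (Finset.mem_filter.2 ⟨hf, h⟩)

open scoped Classical in
/-- De Bruijn's formula: the Pfaffian of `B M Bᵀ` as a sum over increasing tuples. -/
theorem pfSum_deBruijn {N m : ℕ} (e : Fin N × Fin 2 ≃ Fin m) (B : Fin m → ℤ → ℝ) (M : ℤ → ℤ → ℝ)
    (s : Finset ℤ) :
    pfSum e (of fun a b => ∑ p ∈ s, ∑ q ∈ s, B a p * M p q * B b q) =
      ∑ y ∈ (Fintype.piFinset fun _ : Fin m => s).filter StrictMono,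
        (of fun a b => B a (y b)).det * pfSum e (of fun a b => M (y a) (y b)) := by
  have h := pfSum_congruence_symmetrized e B M s
  rw [sum_piFinset_eq_sum_strictMono, Fintype.card_fin] at h
  · exact mul_left_cancel₀ (by positivity) h
  · intro f σ
    have h1 : (of fun a b => B a ((f ∘ σ) b)) = (of fun a b => B a (f b)).submatrix id σ := rfl
    have h2 : (of fun a b => M ((f ∘ σ) a) ((f ∘ σ) b)) =
      (of fun a b => M (f a) (f b)).submatrix σ σ := rfl
    have h3 : ((sign σ : ℤ) : ℝ) * ((sign σ : ℤ) : ℝ) = 1 := by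
      rw [← Int.cast_mul, ← Units.val_mul, Int.units_mul_self]; simp
    rw [h1, h2, det_permute', pfSum_submatrix_perm]
    linear_combination ((of fun a b => B a (f b)).det * pfSum e (of fun a b => M (f a) (f b))) * h3
  · intro f hf
    simp only [Function.Injective, not_forall] at hf
    obtain ⟨a, b, hab, hne⟩ := hf
    rw [det_zero_of_column_eq hne (fun k => by simp [hab]), zero_mul]

/-! ### The parity sign matrix -/

theorem S_antisymm (x y : ℤ) : S y x = -S x y := by
  unfold S
  rw [← neg_sub x y, Int.sign_neg]
  push_cast
  ring

theorem S_self (x : ℤ) : S x x = 0 := by simp [S]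

theorem S_of_lt {x y : ℤ} (h : x < y) : S x y = if Odd x ∧ Even y then -1 else 0 := by
  have h1 : (x - y).sign = -1 := Int.sign_eq_neg_one_of_neg (by omega)
  rw [S, h1]
  rcases Int.even_or_odd x with hx | hx <;> rcases Int.even_or_odd y with hy | hy <;>
    simp [hx, hy, hx.neg_one_zpow, hy.neg_one_zpow]

theorem S_of_gt {x y : ℤ} (h : y < x) : S x y = if Even x ∧ Odd y then 1 else 0 := by
  rw [S_antisymm, S_of_lt h]
  simp only [and_comm]
  split_ifs <;> simp

theorem abs_S_le_one (x y : ℤ) : |S x y| ≤ 1 := by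
  rcases lt_trichotomy x y with h | h | h
  · rw [S_of_lt h]; split_ifs <;> simp
  · rw [h, S_self]; simp
  · rw [S_of_gt h]; split_ifs <;> simp

theorem S_congr_left {x x' y : ℤ} (hp : Even x ↔ Even x') (h : x < y ↔ x' < y) (h' : y < x ↔ y < x') :
    S x y = S x' y := by
  rcases lt_trichotomy x y with hl | hl | hl
  · rw [S_of_lt hl, S_of_lt (h.1 hl)]
    simp only [← Int.not_even_iff_odd, hp]
  · have : x' = y := by omega
    rw [hl, this]
  · rw [S_of_gt hl, S_of_gt (h'.1 hl)]
    simp only [hp]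

/-- The pairing of consecutive lines. -/
def linePairing (N : ℕ) : Fin N × Fin 2 ≃ Fin (2 * N) :=
  finProdFinEquiv.trans (finCongr (mul_comm N 2))

theorem linePairing_val (N : ℕ) (i : Fin N) (b : Fin 2) :
    (linePairing N (i, b) : ℕ) = b + 2 * i := by
  simp [linePairing]

/-- The lowest level `-2N + 1` is odd, so the points alternate odd, even, from below. `S` vanishes
between equal parities, and between odd and even points it is the triangular matrix `U` with entries
`-1`, of determinant `(-1) ^ N`. -/
theorem pfSum_S_alternating (N : ℕ) (y : Fin (2 * N) → ℤ) (hy : StrictMono y)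
    (hp : ∀ j, Even (y j - level N j)) :
    pfSum (linePairing N) (of fun a b => S (y a) (y b)) =
      (-1) ^ N * (2 ^ N * (N.factorial : ℝ)) := by
  let g := (doublePairing (Fin N)).symm.trans (linePairing N)
  have hg : ∀ i b, g (doublePairing (Fin N) (i, b)) = linePairing N (i, b) := by simp [g]
  rw [← pfSum_reindex (doublePairing (Fin N)) (linePairing N) g (Equiv.refl _) (fun i b => hg i b)]
  have g0 : ∀ i, g (Sum.inl i) = linePairing N (i, 0) := fun i => hg i 0
  have g1 : ∀ i, g (Sum.inr i) = linePairing N (i, 1) := fun i => hg i 1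
  have p0 : ∀ i, Odd (y (linePairing N (i, 0))) := by
    intro i
    have := hp (linePairing N (i, 0))
    simp only [level, linePairing_val] at this
    simp only [Int.even_iff, Int.odd_iff, Fin.val_zero, Nat.cast_add, Nat.cast_mul] at this ⊢
    omega
  have p1 : ∀ i, Even (y (linePairing N (i, 1))) := by
    intro i
    have := hp (linePairing N (i, 1))
    simp only [level, linePairing_val] at this
    simp only [Int.even_iff, Fin.val_one, Nat.cast_add, Nat.cast_mul] at this ⊢
    omega
  have p0' : ∀ i, ¬Even (y (linePairing N (i, 0))) := fun i => Int.not_even_iff_odd.2 (p0 i)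
  have p1' : ∀ i, ¬Odd (y (linePairing N (i, 1))) := fun i => Int.not_odd_iff_even.2 (p1 i)
  let U : Matrix (Fin N) (Fin N) ℝ := of fun i j => if i ≤ j then -1 else 0
  have h01 : ∀ i j, S (y (linePairing N (i, 0))) (y (linePairing N (j, 1))) = U i j := by
    intro i j
    by_cases hij : i ≤ j
    · have hlt : linePairing N (i, 0) < linePairing N (j, 1) := by
        rw [Fin.lt_def, linePairing_val, linePairing_val]
        have : (i : ℕ) ≤ j := hij
        simp; omega
      rw [S_of_lt (hy hlt)]
      simp [U, hij, p0, p1]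
    · have hlt : linePairing N (j, 1) < linePairing N (i, 0) := by
        rw [Fin.lt_def, linePairing_val, linePairing_val]
        have : (j : ℕ) < i := not_le.1 hij
        simp; omega
      rw [S_of_gt (hy hlt)]
      simp [U, hij, p0']
  have hsame : ∀ a b, (Even (y a) ↔ Even (y b)) → S (y a) (y b) = 0 := by
    intro a b hab
    rcases lt_trichotomy (y a) (y b) with h | h | h
    · rw [S_of_lt h, if_neg]; rw [← hab, ← Int.not_even_iff_odd]; tauto
    · rw [h, S_self]
    · rw [S_of_gt h, if_neg]; rw [hab, ← Int.not_even_iff_odd]; tauto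
  have hmat : (of fun a b => S (y a) (y b)).submatrix g g = fromBlocks 0 U (-Uᵀ) 0 := by
    ext a b
    rcases a with a | a <;> rcases b with b | b <;>
      simp only [submatrix_apply, of_apply, g0, g1, fromBlocks_apply₁₁, fromBlocks_apply₁₂,
        fromBlocks_apply₂₁, fromBlocks_apply₂₂, Matrix.zero_apply, Matrix.neg_apply,
        transpose_apply]
    · exact hsame _ _ (by simp [p0'])
    · exact h01 a b
    · rw [S_antisymm, h01]
    · exact hsame _ _ (by simp [p1])
  have hdet : U.det = (-1) ^ N := by
    rw [det_of_isUpperTriangular]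
    · simp [U]
    · intro i j hij
      have : ¬ i ≤ j := not_le.2 hij
      simp [U, this]
  rw [hmat, pfSum_fromBlocks_zero_diag, hdet]
  ring

/-- Take the first point `k` of wrong parity. If `k = 0`, the lowest point is even and its row of
`S` is zero. Otherwise the neighbours `k - 1` and `k` have the same parity, with no point between
them, and their rows agree. -/
theorem pfSum_S_not_alternating (N : ℕ) (y : Fin (2 * N) → ℤ) (hy : StrictMono y)
    (hp : ¬∀ j, Even (y j - level N j)) :
    pfSum (linePairing N) (of fun a b => S (y a) (y b)) = 0 := by
  have hp' : ∃ k : ℕ, ∃ h : k < 2 * N, ¬Even (y ⟨k, h⟩ - level N ⟨k, h⟩) := by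
    push Not at hp
    obtain ⟨j, hj⟩ := hp
    exact ⟨j, j.2, by simpa using hj⟩
  classical
  let k := Nat.find hp'
  obtain ⟨hk, hodd⟩ := Nat.find_spec hp'
  have hmin : ∀ m (hm : m < 2 * N), m < k → Even (y ⟨m, hm⟩ - level N ⟨m, hm⟩) := by
    intro m hm hmk
    have := Nat.find_min hp' hmk
    push Not at this
    simpa using this hm
  change ¬Even (y ⟨k, hk⟩ - level N ⟨k, hk⟩) at hodd
  rcases Nat.eq_zero_or_pos k with h0 | hpos
  · have hev : ¬Odd (y ⟨k, hk⟩) := by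
      simp only [level, Int.even_iff, Int.odd_iff] at hodd ⊢
      omega
    have hrow : ∀ b, S (y ⟨k, hk⟩) (y b) = 0 := by
      intro b
      rcases (Fin.le_def.2 (by simp [h0]) : (⟨k, hk⟩ : Fin (2 * N)) ≤ b).eq_or_lt with h | h
      · rw [← h, S_self]
      · rw [S_of_lt (hy h), if_neg (fun h => hev h.1)]
    refine pfSum_eq_zero_of_row _ _ ⟨k, hk⟩ (fun b => ?_) fun b => ?_
    · exact hrow b
    · rw [of_apply, S_antisymm, hrow, neg_zero]
  · have hk' : k - 1 < 2 * N := by omega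
    have hev := hmin (k - 1) hk' (by omega)
    have hpar : Even (y ⟨k - 1, hk'⟩) ↔ Even (y ⟨k, hk⟩) := by
      simp only [level, Int.even_iff] at hev hodd ⊢
      omega
    have hlt : y ⟨k - 1, hk'⟩ < y ⟨k, hk⟩ := hy (by rw [Fin.lt_def]; simp; omega)
    have hrow : ∀ b, S (y ⟨k - 1, hk'⟩) (y b) = S (y ⟨k, hk⟩) (y b) := by
      intro b
      rcases lt_trichotomy b ⟨k - 1, hk'⟩ with h | h | h
      · have := hy h
        exact S_congr_left hpar (by omega) (by omega)
      · rw [h, S_self, S_of_gt hlt, if_neg]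
        rw [← hpar, ← Int.not_even_iff_odd]; tauto
      · rcases (Fin.le_def.2 (by have := Fin.lt_def.1 h; simp at this ⊢; omega) :
          (⟨k, hk⟩ : Fin (2 * N)) ≤ b).eq_or_lt with h' | h'
        · rw [← h', S_self, S_of_lt hlt, if_neg]
          rw [← hpar, ← Int.not_even_iff_odd]; tauto
        · have := hy h'
          exact S_congr_left hpar (by omega) (by omega)
    refine pfSum_eq_zero_of_rows_eq _ _ (p := ⟨k - 1, hk'⟩) (q := ⟨k, hk⟩) ?_ hrow fun r => ?_
    · exact fun h => hlt.ne (congrArg y h)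
    · rw [of_apply, of_apply, S_antisymm, hrow, ← S_antisymm]

end PNG

namespace PNG

open Equiv Equiv.Perm Matrix

/-! ### Counting ordered words: the Karlin–McGregor determinant. -/

section Words

variable {N : ℕ}

theorem level_strictMono (N : ℕ) : StrictMono (level N) := by
  intro i j h
  have : (i : ℕ) < j := h
  simp only [level]
  omega

/-- The height of the line `j` after the first `r` letters of the word `w`. -/
def wordHeight {k : ℕ} (w : Fin k → Fin (2 * N)) (r : ℕ) (j : Fin (2 * N)) : ℤ :=
  level N j + ∑ m : Fin k, if (m : ℕ) < r ∧ w m = j then 1 else 0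

/-- The words for which the lines stay ordered at all times. -/
def GoodWord {k : ℕ} (w : Fin k → Fin (2 * N)) : Prop :=
  ∀ r ≤ k, StrictMono (wordHeight w r)

theorem wordHeight_snoc_of_le {k : ℕ} (w : Fin k → Fin (2 * N)) (a : Fin (2 * N)) {r : ℕ}
    (hr : r ≤ k) : wordHeight (Fin.snoc w a : Fin (k + 1) → Fin (2 * N)) r = wordHeight w r := by
  ext j
  simp only [wordHeight, Fin.sum_univ_castSucc, Fin.snoc_castSucc, Fin.val_castSucc,
    Fin.val_last, not_lt.2 hr, false_and, if_false, add_zero]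

theorem wordHeight_snoc_last {k : ℕ} (w : Fin k → Fin (2 * N)) (a j : Fin (2 * N)) :
    wordHeight (Fin.snoc w a : Fin (k + 1) → Fin (2 * N)) (k + 1) j =
      wordHeight w k j + if a = j then 1 else 0 := by
  simp only [wordHeight, Fin.sum_univ_castSucc, Fin.snoc_castSucc, Fin.snoc_last, Fin.val_castSucc,
    Fin.val_last, lt_add_one, true_and, add_assoc]
  congr 2
  refine Finset.sum_congr rfl fun m _ => ?_
  simp [m.2, m.2.trans (lt_add_one k)]

theorem goodWord_snoc {k : ℕ} (w : Fin k → Fin (2 * N)) (a : Fin (2 * N)) :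
    GoodWord (Fin.snoc w a : Fin (k + 1) → Fin (2 * N)) ↔
      GoodWord w ∧ StrictMono (wordHeight (Fin.snoc w a : Fin (k + 1) → Fin (2 * N)) (k + 1)) := by
  constructor
  · intro h
    refine ⟨fun r hr => ?_, h _ le_rfl⟩
    rw [← wordHeight_snoc_of_le w a hr]
    exact h r (by omega)
  · rintro ⟨h, h'⟩ r hr
    rcases Nat.le_succ_iff.1 hr with h1 | rfl
    · rw [wordHeight_snoc_of_le w a h1]; exact h r h1
    · exact h'

open scoped Classical in
/-- The number of good words of length `k` that lead from the starting levels to `y`. -/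
noncomputable def wordCount (N k : ℕ) (y : Fin (2 * N) → ℤ) : ℕ :=
  (Finset.univ.filter fun w : Fin k → Fin (2 * N) => GoodWord w ∧ wordHeight w k = y).card

theorem wordCount_eq_zero {k : ℕ} {y : Fin (2 * N) → ℤ} (hy : ¬StrictMono y) :
    wordCount N k y = 0 := by
  classical
  rw [wordCount, Finset.card_eq_zero, Finset.filter_eq_empty_iff]
  rintro w - ⟨h1, h2⟩
  exact hy (h2 ▸ h1 k le_rfl)

theorem wordCount_zero (y : Fin (2 * N) → ℤ) :
    wordCount N 0 y = if y = level N then 1 else 0 := by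
  classical
  have h : ∀ (w : Fin 0 → Fin (2 * N)) r, wordHeight w r = level N := by
    intro w r; ext j; simp [wordHeight]
  have hg : ∀ w : Fin 0 → Fin (2 * N), GoodWord w := by
    intro w r _; rw [h]; exact level_strictMono N
  simp only [wordCount, h, hg, true_and, eq_comm (a := level N)]
  split_ifs with hy <;> simp [hy]

theorem wordCount_succ (k : ℕ) {y : Fin (2 * N) → ℤ} (hy : StrictMono y) :
    wordCount N (k + 1) y = ∑ a, wordCount N k (Function.update y a (y a - 1)) := by
  classical
  simp only [wordCount, Finset.card_filter]
  rw [← Fintype.sum_equiv (Fin.snocEquiv fun _ : Fin (k + 1) => Fin (2 * N))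
    (fun p => if GoodWord (Fin.snoc p.2 p.1 : Fin (k + 1) → Fin (2 * N)) ∧
      wordHeight (Fin.snoc p.2 p.1 : Fin (k + 1) → Fin (2 * N)) (k + 1) = y then 1 else 0) _
    (fun p => rfl), Fintype.sum_prod_type]
  refine Finset.sum_congr rfl fun a _ => Finset.sum_congr rfl fun w _ => ?_
  congr 1
  rw [goodWord_snoc, eq_iff_iff]
  have h : wordHeight (Fin.snoc w a : Fin (k + 1) → Fin (2 * N)) (k + 1) = y ↔
      wordHeight w k = Function.update y a (y a - 1) := by
    simp only [funext_iff, wordHeight_snoc_last]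
    refine forall_congr' fun j => ?_
    rcases eq_or_ne a j with rfl | hj
    · simp; omega
    · simp [hj, Function.update_of_ne hj.symm]
  constructor
  · rintro ⟨⟨h1, -⟩, h2⟩
    exact ⟨h1, h.1 h2⟩
  · rintro ⟨h1, h2⟩
    have h3 := h.2 h2
    exact ⟨⟨h1, by rw [h3]; exact hy⟩, h3⟩

/-- The Karlin–McGregor determinant. -/
noncomputable def kmDet (N : ℕ) (T : ℝ) (y : Fin (2 * N) → ℤ) : ℝ :=
  (of fun a b => Phi T (y b) (level N a)).det

theorem Phi_sub_one (T : ℝ) (x i : ℤ) :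
    Ttilde T * Phi T (x - 1) i = ((x - i : ℤ) : ℝ) * Phi T x i := by
  rcases lt_trichotomy x i with h | rfl | h
  · simp [Phi, not_le.2 h, show ¬ i ≤ x - 1 by omega]
  · simp [Phi]
  · obtain ⟨n, rfl⟩ : ∃ n : ℕ, x = i + n + 1 := ⟨(x - i - 1).toNat, by omega⟩
    have h1 : (i + n + 1 - 1 - i).toNat = n := by omega
    have h2 : (i + n + 1 - i).toNat = n + 1 := by omega
    simp only [Phi, h1, h2, if_pos (show i ≤ i + n + 1 - 1 by omega),
      if_pos (show i ≤ i + n + 1 by omega), Nat.factorial_succ]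
    push_cast
    field_simp
    ring

/-- In each Leibniz term, lowering `y a` multiplies by `y a - level N (σ a)`, up to `Ttilde T`. The
sum of these factors over `a` does not depend on `σ`. -/
theorem kmDet_recursion (T : ℝ) (y : Fin (2 * N) → ℤ) :
    Ttilde T * ∑ a, kmDet N T (Function.update y a (y a - 1)) =
      ((∑ a, (y a - level N a) : ℤ) : ℝ) * kmDet N T y := by
  simp only [kmDet, det_apply', of_apply]
  rw [Finset.sum_comm, Finset.mul_sum, Finset.mul_sum]
  refine Finset.sum_congr rfl fun σ _ => ?_
  have h : ∀ a, Ttilde T * ∏ i, Phi T (Function.update y a (y a - 1) i) (level N (σ i)) =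
      ((y a - level N (σ a) : ℤ) : ℝ) * ∏ i, Phi T (y i) (level N (σ i)) := by
    intro a
    rw [← Finset.mul_prod_erase _ _ (Finset.mem_univ a),
      ← Finset.mul_prod_erase _ (fun i => Phi T (y i) (level N (σ i))) (Finset.mem_univ a),
      Function.update_self, ← mul_assoc, Phi_sub_one, mul_assoc]
    congr 2
    refine Finset.prod_congr rfl fun i hi => ?_
    rw [Function.update_of_ne (Finset.ne_of_mem_erase hi)]
  have h2 : (∑ a, (y a - level N a) : ℤ) = ∑ a, (y a - level N (σ a)) := by
    rw [Finset.sum_sub_distrib, Finset.sum_sub_distrib, Equiv.sum_comp σ (level N)]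
  rw [← Finset.mul_sum, mul_left_comm, Finset.mul_sum, Finset.sum_congr rfl fun a _ => h a,
    ← Finset.sum_mul, h2]
  push_cast
  ring

/-- A nonzero Leibniz term needs `level N (σ i) ≤ y i` for all `i`. A nonpositive total displacement
then forces equalities, and monotonicity forces `σ = 1`. -/
theorem kmDet_of_sum_nonpos (T : ℝ) {y : Fin (2 * N) → ℤ} (hy : StrictMono y)
    (hs : ∑ a, (y a - level N a) ≤ 0) : kmDet N T y = if y = level N then 1 else 0 := by
  have key : ∀ σ : Perm (Fin (2 * N)), ∏ i, Phi T (y i) (level N (σ i)) ≠ 0 →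
      y = level N ∧ σ = 1 := by
    intro σ hσ
    have h1 : ∀ i, level N (σ i) ≤ y i := by
      intro i
      by_contra hlt
      exact hσ (Finset.prod_eq_zero (Finset.mem_univ i) (by simp [Phi, hlt]))
    have h2 : ∑ i, (y i - level N (σ i)) ≤ 0 := by
      rwa [Finset.sum_sub_distrib, Equiv.sum_comp σ (level N), ← Finset.sum_sub_distrib]
    have h3 : ∀ i, y i = level N (σ i) := by
      have h4 : ∑ i, (y i - level N (σ i)) = 0 :=
        le_antisymm h2 (Finset.sum_nonneg fun i _ => by linarith [h1 i])
      intro i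
      have := (Finset.sum_eq_zero_iff_of_nonneg fun i _ => by linarith [h1 i]).1 h4 i
        (Finset.mem_univ i)
      linarith
    have h5 : y = level N := by
      apply (StrictMono.range_inj hy (level_strictMono N)).1
      rw [← σ.surjective.range_comp (level N)]
      exact congrArg Set.range (funext h3)
    refine ⟨h5, ?_⟩
    ext i
    have := h3 i
    rw [h5] at this
    exact congrArg _ ((level_strictMono N).injective this).symm
  rw [kmDet, det_apply']
  simp only [of_apply]
  split_ifs with h
  · rw [Finset.sum_eq_single_of_mem 1 (Finset.mem_univ _)]
    · simp [h, Phi]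
    · intro σ _ hσ
      by_contra hne
      exact hσ (key σ (right_ne_zero_of_mul hne)).2
  · refine Finset.sum_eq_zero fun σ _ => ?_
    by_contra hne
    exact h (key σ (right_ne_zero_of_mul hne)).1

theorem kmDet_eq_zero_of_not_injective (T : ℝ) {y : Fin (2 * N) → ℤ}
    (hy : ¬Function.Injective y) : kmDet N T y = 0 := by
  simp only [Function.Injective, not_forall] at hy
  obtain ⟨a, b, hab, hne⟩ := hy
  exact det_zero_of_column_eq hne fun k => by simp [hab]

/-- Both sides obey the recursion that removes the last jump. Lowering one coordinate of an
increasing `y` can at worst create a coincidence; there the count vanishes and so does the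
determinant. This matching boundary condition is why the determinant counts non-intersecting paths.
-/
theorem wordCount_mul (T : ℝ) (k : ℕ) (y : Fin (2 * N) → ℤ) (hy : Monotone y) :
    (wordCount N k y : ℝ) * (Ttilde T ^ k / k.factorial) =
      if ∑ a, (y a - level N a) = k then kmDet N T y else 0 := by
  by_cases hs : StrictMono y
  swap
  · have : ¬Function.Injective y := fun h => hs (hy.strictMono_of_injective h)
    simp [wordCount_eq_zero hs, kmDet_eq_zero_of_not_injective T this]
  induction k generalizing y with
  | zero =>
    rw [wordCount_zero]
    split_ifs with h1 h2 h2
    · rw [kmDet_of_sum_nonpos T hs (by simpa using h2.le)]; simp [h1]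
    · exact absurd (by simp [h1]) h2
    · rw [kmDet_of_sum_nonpos T hs (by simpa using h2.le)]; simp [h1]
    · simp
  | succ k ih =>
    have hstep : ∀ a, (wordCount N k (Function.update y a (y a - 1)) : ℝ) *
        (Ttilde T ^ k / k.factorial) =
        if ∑ a, (y a - level N a) = (k + 1 : ℕ) then
          kmDet N T (Function.update y a (y a - 1)) else 0 := by
      intro a
      have hmono : Monotone (Function.update y a (y a - 1)) := by
        intro i j hij
        rcases hij.eq_or_lt with rfl | hlt
        · exact le_rfl
        · have := hs hlt
          rcases eq_or_ne i a with rfl | hi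
          · rw [Function.update_self, Function.update_of_ne hlt.ne']; omega
          · rw [Function.update_of_ne hi]
            rcases eq_or_ne j a with rfl | hj
            · rw [Function.update_self]; omega
            · rw [Function.update_of_ne hj]; omega
      have hsum : ∑ b, (Function.update y a (y a - 1) b - level N b) =
          ∑ b, (y b - level N b) - 1 := by
        rw [Finset.sum_sub_distrib, Finset.sum_sub_distrib, Finset.sum_update_of_mem
          (Finset.mem_univ a), ← Finset.add_sum_erase _ y (Finset.mem_univ a),
          Finset.sdiff_singleton_eq_erase]
        ring
      have hiff : (∑ b, (Function.update y a (y a - 1) b - level N b) = (k : ℤ)) ↔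
          ∑ a, (y a - level N a) = (k + 1 : ℕ) := by
        rw [hsum]; push_cast; omega
      by_cases hs' : StrictMono (Function.update y a (y a - 1))
      · rw [ih _ hmono hs']
        simp only [hiff]
      · have : ¬Function.Injective (Function.update y a (y a - 1)) :=
          fun h => hs' (hmono.strictMono_of_injective h)
        simp [wordCount_eq_zero hs', kmDet_eq_zero_of_not_injective T this]
    have hrec := kmDet_recursion T y
    have hexp : (wordCount N (k + 1) y : ℝ) * (Ttilde T ^ (k + 1) / (k + 1).factorial) =
        Ttilde T / (k + 1) * ∑ a, (wordCount N k (Function.update y a (y a - 1)) : ℝ) *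
          (Ttilde T ^ k / k.factorial) := by
      rw [wordCount_succ k hs, ← Finset.sum_mul, Nat.factorial_succ]
      push_cast
      field_simp
      ring
    rw [hexp, Finset.sum_congr rfl fun a _ => hstep a]
    split_ifs with h
    · rw [h] at hrec
      push_cast at hrec
      have hk : (k : ℝ) + 1 ≠ 0 := by positivity
      field_simp
      linear_combination hrec
    · simp

/-- The Karlin–McGregor formula for up-jumping walks. -/
theorem hasSum_wordCount (T : ℝ) {y : Fin (2 * N) → ℤ} (hy : StrictMono y) :
    HasSum (fun k : ℕ => (wordCount N k y : ℝ) * (Ttilde T ^ k / k.factorial)) (kmDet N T y) := by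
  simp only [wordCount_mul T _ y hy.monotone]
  rcases le_or_gt 0 (∑ a, (y a - level N a)) with h | h
  · lift ∑ a, (y a - level N a) to ℕ using h with m hm
    simp only [Nat.cast_inj, eq_comm (a := m)]
    exact hasSum_ite_eq m (kmDet N T y)
  · have h1 : ∀ k : ℕ, ¬∑ a, (y a - level N a) = (k : ℤ) := by intro k; omega
    have h2 : y ≠ level N := by
      rintro rfl
      simp at h
    simp only [h1, if_false, kmDet_of_sum_nonpos T hy h.le, h2]
    exact hasSum_zero

end Words

end PNG

namespace PNG

open MeasureTheory Equiv

/-! ### The volume of the simplex of ordered times. -/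

section Simplex

/-- The simplex of ordered jump times. -/
def timeSimplex (k : ℕ) (L : ℝ) : Set (Fin k → ℝ) :=
  {t | StrictMono t ∧ ∀ m, t m ∈ Set.Ioo 0 L}

theorem measurableSet_timeSimplex (k : ℕ) (L : ℝ) : MeasurableSet (timeSimplex k L) := by
  have h : timeSimplex k L = (⋂ i, ⋂ j, ⋂ (_ : i < j), {t : Fin k → ℝ | t i < t j}) ∩
      ⋂ m, (fun t : Fin k → ℝ => t m) ⁻¹' Set.Ioo 0 L := by
    ext t
    simp only [timeSimplex, Set.mem_ofPred_eq, Set.mem_inter_iff, Set.mem_iInter, Set.mem_preimage]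
    rfl
  rw [h]
  refine MeasurableSet.inter ?_ ?_
  · refine MeasurableSet.iInter fun i => MeasurableSet.iInter fun j => MeasurableSet.iInter fun _ =>
      measurableSet_lt (measurable_pi_apply i) (measurable_pi_apply j)
  · exact MeasurableSet.iInter fun m => measurable_pi_apply m measurableSet_Ioo

theorem ae_injective (k : ℕ) : ∀ᵐ t : Fin k → ℝ, Function.Injective t := by
  have h : ∀ i j : Fin k, i ≠ j → ∀ᵐ t : Fin k → ℝ, t i ≠ t j := by
    intro i j hij
    let s : Submodule ℝ (Fin k → ℝ) :=
      LinearMap.ker (LinearMap.proj (R := ℝ) (φ := fun _ : Fin k => ℝ) i - LinearMap.proj j)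
    have hs : s ≠ ⊤ := by
      intro htop
      have : Pi.single i (1 : ℝ) ∈ s := htop ▸ Submodule.mem_top
      simp [s, hij.symm] at this
    have h0 := Measure.addHaar_submodule (volume : Measure (Fin k → ℝ)) s hs
    rw [ae_iff]
    convert h0 using 2
    ext t
    simp [s, sub_eq_zero]
  have h2 : ∀ᵐ t : Fin k → ℝ, ∀ i j, i ≠ j → t i ≠ t j := by
    rw [ae_all_iff]; intro i
    rw [ae_all_iff]; intro j
    by_cases hij : i = j
    · simp [hij]
    · filter_upwards [h i j hij] with t ht _ using ht
  filter_upwards [h2] with t ht i j hij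
  by_contra hne
  exact ht i j hne hij

/-- The `k!` images of the simplex under coordinate permutations are disjoint, have equal volume,
and fill the cube up to the null set of tuples with repeated entries. -/
theorem volume_timeSimplex (k : ℕ) {L : ℝ} (hL : 0 ≤ L) :
    volume (timeSimplex k L) = ENNReal.ofReal (L ^ k / k.factorial) := by
  let P : Perm (Fin k) → Set (Fin k → ℝ) := fun σ => {t | t ∘ σ ∈ timeSimplex k L}
  have hP : ∀ σ, volume (P σ) = volume (timeSimplex k L) := by
    intro σ
    have hmp := volume_measurePreserving_piCongrLeft (fun _ : Fin k => ℝ) σ.symm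
    rw [← hmp.measure_preimage (measurableSet_timeSimplex k L).nullMeasurableSet]
    congr 1
    ext t
    have : MeasurableEquiv.piCongrLeft (fun _ : Fin k => ℝ) σ.symm t = t ∘ σ := by
      ext i
      have := MeasurableEquiv.piCongrLeft_apply_apply (β := fun _ : Fin k => ℝ) σ.symm t (σ i)
      simpa using this
    simp [P, this]
  have hmeas : ∀ σ, MeasurableSet (P σ) := fun σ =>
    (measurable_pi_lambda _ fun i => measurable_pi_apply (σ i)) (measurableSet_timeSimplex k L)
  have hdisj : Pairwise (Function.onFun Disjoint P) := by
    intro σ τ hne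
    rw [Function.onFun, Set.disjoint_left]
    rintro t ⟨h1, -⟩ ⟨h2, -⟩
    apply hne
    have hinj : Function.Injective t := by
      have := h1.injective.comp σ.symm.injective
      simpa [Function.comp_assoc] using this
    have h3 : t ∘ σ = t ∘ τ := by
      apply (StrictMono.range_inj h1 h2).1
      rw [σ.surjective.range_comp, τ.surjective.range_comp]
    ext i
    exact congrArg _ (hinj (congrFun h3 i))
  have hunion : (⋃ σ, P σ) =ᵐ[volume] (Set.univ.pi fun _ : Fin k => Set.Ioo (0 : ℝ) L) := by
    filter_upwards [ae_injective k] with t ht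
    apply propext
    change t ∈ (⋃ σ, P σ) ↔ t ∈ (Set.univ.pi fun _ : Fin k => Set.Ioo (0 : ℝ) L)
    simp only [Set.mem_iUnion, Set.mem_univ_pi]
    constructor
    · rintro ⟨σ, -, h⟩ i
      simpa using h (σ.symm i)
    · intro h
      exact ⟨Tuple.sort t, (Tuple.monotone_sort t).strictMono_of_injective
        (ht.comp (Tuple.sort t).injective), fun m => h _⟩
  have htot := measure_congr hunion
  rw [measure_iUnion hdisj hmeas, tsum_fintype] at htot
  simp only [hP, Finset.sum_const, Finset.card_univ, Fintype.card_perm, Fintype.card_fin,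
    Real.volume_pi_Ioo, sub_zero, Finset.prod_const, nsmul_eq_mul] at htot
  rw [← ENNReal.ofReal_pow hL] at htot
  rw [ENNReal.ofReal_div_of_pos (by positivity), ENNReal.ofReal_natCast, ← htot, mul_comm,
    ENNReal.mul_div_cancel_right (by positivity) (by simp)]

end Simplex

/-! ### From the jump measure to the law of the end points. -/

section JumpMeasure

variable {N : ℕ}

theorem measurableEmbedding_sigmaMk {β : ℕ → Type*} [∀ k, MeasurableSpace (β k)] (k : ℕ) :
    MeasurableEmbedding (Sigma.mk k : β k → Sigma β) where
  injective := sigma_mk_injective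
  measurable := by
    intro s hs
    exact MeasurableSpace.measurableSet_iInf.1 hs k
  measurableSet_image' := by
    intro s hs
    refine MeasurableSpace.measurableSet_iInf.2 fun l => ?_
    change MeasurableSet (Sigma.mk l ⁻¹' (Sigma.mk k '' s))
    rcases eq_or_ne k l with rfl | h
    · rwa [Set.preimage_image_eq _ sigma_mk_injective]
    · rw [Set.preimage_image_sigmaMk_of_ne h.symm]
      exact MeasurableSet.empty

theorem measurable_of_comp_sigmaMk {β : ℕ → Type*} [∀ k, MeasurableSpace (β k)] {γ : Type*}
    [MeasurableSpace γ] {f : Sigma β → γ} (h : ∀ k, Measurable fun b => f ⟨k, b⟩) :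
    Measurable f := fun _ hs => MeasurableSpace.measurableSet_iInf.2 fun k => h k hs

theorem Ttilde_eq (T : ℝ) : Ttilde T = Real.sqrt intensity * finalTime T := by
  rw [Ttilde, finalTime, intensity, ← mul_assoc, Real.mul_self_sqrt (by norm_num)]

/-- An event that depends only on the word has each word weighted by `√2 ^ k` times the simplex
volume `(√2 T) ^ k / k!`; this is where `Ttilde T = 2T` comes from. -/
theorem jumpMeasure_apply {T : ℝ} (hT : 0 < T) (Q : Set (LineConfig N))
    (W : ∀ k, Finset (Fin k → Fin (2 * N)))
    (hQ : ∀ k w, ∀ t ∈ timeSimplex k (finalTime T), (⟨k, (w, t)⟩ : LineConfig N) ∈ Q ↔ w ∈ W k) :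
    jumpMeasure N T Q =
      ∑' k : ℕ, ENNReal.ofReal ((W k).card * (Ttilde T ^ k / k.factorial)) := by
  have hL : 0 ≤ finalTime T := by unfold finalTime; positivity
  -- A countable sum of measures can be evaluated on any set, so `Q` need not be measurable.
  rw [jumpMeasure, Measure.sum_apply_of_countable]
  refine tsum_congr fun k => ?_
  have hemb := measurableEmbedding_sigmaMk
    (β := fun k : ℕ => (Fin k → Fin (2 * N)) × (Fin k → ℝ)) k
  rw [hemb.map_apply, Measure.smul_apply]
  set ν : Measure (Fin k → ℝ) := volume.restrict (timeSimplex k (finalTime T)) with hν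
  change _ • ((Measure.count : Measure (Fin k → Fin (2 * N))).prod ν) _ = _
  have hae : ∀ᵐ p ∂((Measure.count : Measure (Fin k → Fin (2 * N))).prod ν),
      p.2 ∈ timeSimplex k (finalTime T) :=
    Measure.quasiMeasurePreserving_snd.ae (ae_restrict_mem (measurableSet_timeSimplex k _))
  have hset : ((fun p => (⟨k, p⟩ : LineConfig N)) ⁻¹' Q) =ᵐ[
      (Measure.count : Measure (Fin k → Fin (2 * N))).prod ν] (W k : Set _) ×ˢ Set.univ := by
    filter_upwards [hae] with p hp
    apply propext
    change (⟨k, (p.1, p.2)⟩ : LineConfig N) ∈ Q ↔ p ∈ (W k : Set _) ×ˢ Set.univ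
    rw [hQ k p.1 p.2 hp]
    simp
  rw [measure_congr hset, Measure.prod_prod, Measure.count_apply_finset, hν,
    Measure.restrict_apply_univ, volume_timeSimplex k hL, smul_eq_mul,
    ← ENNReal.ofReal_natCast (W k).card, ← ENNReal.ofReal_mul (by positivity),
    ← ENNReal.ofReal_mul (by positivity), Ttilde_eq, mul_pow]
  congr 1
  ring

theorem isFiniteMeasure_jumpMeasure (N : ℕ) {T : ℝ} (hT : 0 < T) :
    IsFiniteMeasure (jumpMeasure N T) := by
  refine ⟨?_⟩
  rw [jumpMeasure_apply hT Set.univ (fun _ => Finset.univ) (by simp)]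
  have hs : Summable fun k : ℕ => ((2 * N * Ttilde T) ^ k / k.factorial : ℝ) :=
    Real.summable_pow_div_factorial _
  convert hs.tsum_ofReal_lt_top using 4 with k
  simp [mul_pow]
  ring

theorem height_eq_wordHeight {k : ℕ} (w : Fin k → Fin (2 * N)) (t : Fin k → ℝ) {s : ℝ} {r : ℕ}
    (h : ∀ m, t m ≤ s ↔ (m : ℕ) < r) (j : Fin (2 * N)) :
    height (⟨k, (w, t)⟩ : LineConfig N) j s = wordHeight w r j := by
  simp [height, wordHeight, h, and_comm]

theorem exists_prefix_of_time {k : ℕ} {t : Fin k → ℝ} (ht : StrictMono t) (s : ℝ) :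
    ∃ r ≤ k, ∀ m, t m ≤ s ↔ (m : ℕ) < r := by
  by_cases h : ∃ m, s < t m
  · obtain ⟨m, hm, hmin⟩ := WellFounded.has_min (wellFounded_lt (α := Fin k)) {m | s < t m} h
    refine ⟨m, m.2.le, fun i => ⟨fun hi => ?_, fun hi => ?_⟩⟩
    · exact ht.lt_iff_lt.1 (hi.trans_lt hm)
    · by_contra hlt
      exact hmin i (not_le.1 hlt) hi
  · push Not at h
    exact ⟨k, le_rfl, fun m => by simp [h m]⟩

theorem height_finalTime {T : ℝ} {k : ℕ} (w : Fin k → Fin (2 * N)) {t : Fin k → ℝ}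
    (ht : t ∈ timeSimplex k (finalTime T)) (j : Fin (2 * N)) :
    height (⟨k, (w, t)⟩ : LineConfig N) j (finalTime T) = wordHeight w k j :=
  height_eq_wordHeight w t (fun m => by simp [(ht.2 m).2.le]) j

theorem height_zero {T : ℝ} {k : ℕ} (w : Fin k → Fin (2 * N)) {t : Fin k → ℝ}
    (ht : t ∈ timeSimplex k (finalTime T)) (j : Fin (2 * N)) :
    height (⟨k, (w, t)⟩ : LineConfig N) j 0 = level N j := by
  rw [height_eq_wordHeight w t (r := 0) (fun m => by simp [(ht.2 m).1]) j]
  simp [wordHeight]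

/-- Heights change only at jumps, so order at all times is order after every prefix of the word. -/
theorem mem_allowed_iff {T : ℝ} (hT : 0 < T) {k : ℕ} (w : Fin k → Fin (2 * N)) {t : Fin k → ℝ}
    (ht : t ∈ timeSimplex k (finalTime T)) :
    (⟨k, (w, t)⟩ : LineConfig N) ∈ Allowed N T ↔
      GoodWord w ∧ ∀ j, Even (wordHeight w k j - level N j) := by
  have hL : 0 ≤ finalTime T := by unfold finalTime; positivity
  simp only [Allowed, Set.mem_ofPred_eq, height_finalTime w ht, height_zero w ht]
  refine and_congr_left fun _ => ⟨fun h r hr => ?_, fun h s _ => ?_⟩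
  · obtain ⟨s, hs, hsr⟩ : ∃ s ∈ Set.Icc 0 (finalTime T), ∀ m, t m ≤ s ↔ (m : ℕ) < r := by
      rcases Nat.eq_zero_or_pos r with rfl | hpos
      · exact ⟨0, ⟨le_rfl, hL⟩, fun m => by simp [(ht.2 m).1]⟩
      -- The prefix of length `r` is seen at the time of its last jump, with index `r - 1`, since
      -- `height` includes jumps at time `s` itself.
      · refine ⟨t ⟨r - 1, by omega⟩, ⟨(ht.2 _).1.le, (ht.2 _).2.le⟩, fun m => ?_⟩
        rw [ht.1.le_iff_le, Fin.le_def]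
        simp only
        omega
    have := h s hs
    simpa only [height_eq_wordHeight w t hsr] using this
  · obtain ⟨r, hr, hsr⟩ := exists_prefix_of_time ht.1 s
    simpa only [height_eq_wordHeight w t hsr] using h r hr

theorem measurable_height (j : Fin (2 * N)) (s : ℝ) :
    Measurable fun ω : LineConfig N => height ω j s := by
  refine measurable_of_comp_sigmaMk fun k => ?_
  have h : (fun b : (Fin k → Fin (2 * N)) × (Fin k → ℝ) => height (⟨k, b⟩ : LineConfig N) j s) =
      fun b => level N j + ∑ m : Fin k, if b.1 m = j ∧ b.2 m ≤ s then (1 : ℤ) else 0 := by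
    ext b
    simp [height]
  rw [h]
  refine Measurable.const_add (Finset.measurable_sum _ fun m _ => ?_) _
  refine Measurable.ite ?_ measurable_const measurable_const
  refine MeasurableSet.inter ?_ ?_
  · exact measurableSet_eq_fun ((measurable_pi_apply m).comp measurable_fst) measurable_const
  · exact measurableSet_le ((measurable_pi_apply m).comp measurable_snd) measurable_const

/-- The end points of all lines. -/
noncomputable def endpoints (N : ℕ) (T : ℝ) (ω : LineConfig N) : Fin (2 * N) → ℤ :=
  fun j => height ω j (finalTime T)

theorem measurable_endpoints (N : ℕ) (T : ℝ) : Measurable (endpoints N T) :=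
  measurable_pi_lambda _ fun j => measurable_height j _

open scoped Classical in
/-- The weight of the allowed configurations with end points `y`. -/
noncomputable def lineWeight (N : ℕ) (T : ℝ) (y : Fin (2 * N) → ℤ) : ℝ :=
  if StrictMono y ∧ ∀ j, Even (y j - level N j) then kmDet N T y else 0

theorem kmDet_nonneg {T : ℝ} (hT : 0 < T) {y : Fin (2 * N) → ℤ} (hy : StrictMono y) :
    0 ≤ kmDet N T y :=
  (hasSum_wordCount T hy).nonneg fun k => by unfold Ttilde; positivity

theorem lineWeight_nonneg {T : ℝ} (hT : 0 < T) (y : Fin (2 * N) → ℤ) : 0 ≤ lineWeight N T y := by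
  unfold lineWeight
  split_ifs with h
  · exact kmDet_nonneg hT h.1
  · exact le_rfl

/-- The law of the end points before normalization. -/
noncomputable def endpointMeasure (N : ℕ) (T : ℝ) : Measure (Fin (2 * N) → ℤ) :=
  ((jumpMeasure N T).restrict (Allowed N T)).map (endpoints N T)

theorem endpointMeasure_singleton {T : ℝ} (hT : 0 < T) (y : Fin (2 * N) → ℤ) :
    endpointMeasure N T {y} = ENNReal.ofReal (lineWeight N T y) := by
  classical
  rw [endpointMeasure, Measure.map_apply (measurable_endpoints N T) (measurableSet_singleton y),
    Measure.restrict_apply (measurable_endpoints N T (measurableSet_singleton y))]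
  have hend : ∀ k (w : Fin k → Fin (2 * N)), ∀ t ∈ timeSimplex k (finalTime T),
      endpoints N T ⟨k, (w, t)⟩ = wordHeight w k := fun k w t ht =>
    funext fun j => height_finalTime w ht j
  rw [jumpMeasure_apply hT _ (fun k => Finset.univ.filter fun w =>
    wordHeight w k = y ∧ GoodWord w ∧ ∀ j, Even (wordHeight w k j - level N j))
    (fun k w t ht => by
      simp [mem_allowed_iff hT w ht, hend k w t ht])]
  by_cases hy : StrictMono y ∧ ∀ j, Even (y j - level N j)
  · have hcard : ∀ k, (Finset.univ.filter fun w : Fin k → Fin (2 * N) => wordHeight w k = y ∧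
        GoodWord w ∧ ∀ j, Even (wordHeight w k j - level N j)).card = wordCount N k y := by
      intro k
      rw [wordCount]
      congr 1
      refine Finset.filter_congr fun w _ => ⟨fun h => ⟨h.2.1, h.1⟩, fun h => ⟨h.2, h.1, ?_⟩⟩
      rw [h.2]; exact hy.2
    simp only [hcard]
    have hs := hasSum_wordCount T hy.1
    rw [← ENNReal.ofReal_tsum_of_nonneg (fun k => by unfold Ttilde; positivity) hs.summable,
      hs.tsum_eq, lineWeight, if_pos hy]
  · have hcard : ∀ k, (Finset.univ.filter fun w : Fin k → Fin (2 * N) => wordHeight w k = y ∧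
        GoodWord w ∧ ∀ j, Even (wordHeight w k j - level N j)).card = 0 := by
      intro k
      rw [Finset.card_eq_zero, Finset.filter_eq_empty_iff]
      rintro w - ⟨h1, h2, h3⟩
      exact hy ⟨h1 ▸ h2 k le_rfl, h1 ▸ h3⟩
    simp [hcard, lineWeight, hy]

theorem isFiniteMeasure_endpointMeasure (N : ℕ) {T : ℝ} (hT : 0 < T) :
    IsFiniteMeasure (endpointMeasure N T) := by
  have := isFiniteMeasure_jumpMeasure N hT
  unfold endpointMeasure
  infer_instance

theorem endpointMeasure_apply {T : ℝ} (hT : 0 < T) (s : Set (Fin (2 * N) → ℤ)) :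
    endpointMeasure N T s = ∑' y, s.indicator (fun y => ENNReal.ofReal (lineWeight N T y)) y := by
  rw [← Measure.tsum_indicator_apply_singleton _ s s.to_countable.measurableSet]
  simp only [endpointMeasure_singleton hT]

theorem summable_lineWeight (N : ℕ) {T : ℝ} (hT : 0 < T) : Summable (lineWeight N T) := by
  have := isFiniteMeasure_endpointMeasure N hT
  have h := endpointMeasure_apply (N := N) hT Set.univ
  simp only [Set.indicator_univ] at h
  have h2 := ENNReal.summable_toReal (h ▸ measure_ne_top (endpointMeasure N T) Set.univ)
  exact h2.congr fun y => ENNReal.toReal_ofReal (lineWeight_nonneg hT y)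

/-- The configuration without jumps; it makes the partition function positive. -/
theorem lineWeight_level (N : ℕ) (T : ℝ) : lineWeight N T (level N) = 1 := by
  rw [lineWeight, if_pos ⟨level_strictMono N, by simp⟩,
    kmDet_of_sum_nonpos T (level_strictMono N) (by simp), if_pos rfl]

/-- The partition function. -/
noncomputable def partitionFunction (N : ℕ) (T : ℝ) : ℝ := ∑' y, lineWeight N T y

theorem partitionFunction_pos (N : ℕ) {T : ℝ} (hT : 0 < T) : 0 < partitionFunction N T :=
  (summable_lineWeight N hT).tsum_pos (lineWeight_nonneg hT) (level N)
    (by rw [lineWeight_level]; norm_num)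

theorem endpointMeasure_real_apply {T : ℝ} (hT : 0 < T) (s : Set (Fin (2 * N) → ℤ)) :
    (endpointMeasure N T).real s = ∑' y, s.indicator (lineWeight N T) y := by
  rw [Measure.real, endpointMeasure_apply hT, ENNReal.tsum_toReal_eq]
  · refine tsum_congr fun y => ?_
    by_cases hy : y ∈ s
    · simp [hy, ENNReal.toReal_ofReal (lineWeight_nonneg hT y)]
    · simp [hy]
  · intro y
    by_cases hy : y ∈ s <;> simp [hy]

theorem jumpMeasure_allowed {T : ℝ} (hT : 0 < T) :
    (jumpMeasure N T).real (Allowed N T) = partitionFunction N T := by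
  have h := endpointMeasure_real_apply (N := N) hT Set.univ
  rw [Set.indicator_univ, Measure.real, endpointMeasure,
    Measure.map_apply (measurable_endpoints N T) MeasurableSet.univ, Set.preimage_univ,
    Measure.restrict_apply_univ] at h
  exact h

theorem isProbabilityMeasure_lineEnsemble (N : ℕ) {T : ℝ} (hT : 0 < T) :
    IsProbabilityMeasure (lineEnsemble N T) := by
  have := isFiniteMeasure_jumpMeasure N hT
  refine ProbabilityTheory.cond_isProbabilityMeasure fun h => ?_
  have h2 := jumpMeasure_allowed (N := N) hT
  rw [Measure.real, h] at h2
  exact (partitionFunction_pos N hT).ne h2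

theorem correlation_eq {T : ℝ} (hT : 0 < T) (n : ℕ) (x : Fin n → ℤ) :
    partitionFunction N T * correlation N T n x =
      ∑' y, (∑ f : Fin n ↪ Fin (2 * N), if ∀ i, y (f i) = x i then 1 else 0) *
        lineWeight N T y := by
  have hsum := summable_lineWeight N hT
  have h1 : ∀ f : Fin n ↪ Fin (2 * N), partitionFunction N T *
      (lineEnsemble N T).real {ω | ∀ i, height ω (f i) (finalTime T) = x i} =
        ∑' y, (if ∀ i, y (f i) = x i then 1 else 0) * lineWeight N T y := by
    intro f
    have hset : {ω | ∀ i, height ω (f i) (finalTime T) = x i} =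
        endpoints N T ⁻¹' {y | ∀ i, y (f i) = x i} := rfl
    have hms : MeasurableSet {y : Fin (2 * N) → ℤ | ∀ i, y (f i) = x i} :=
      (Set.to_countable _).measurableSet
    have hm := measurable_endpoints N T hms
    -- This form of conditioning uses measurability of the end point event, not of `Allowed N T`.
    rw [hset, lineEnsemble, Measure.real, ProbabilityTheory.cond_apply' hm, ENNReal.toReal_mul,
      ENNReal.toReal_inv]
    change _ * (((jumpMeasure N T).real (Allowed N T))⁻¹ * _) = _
    rw [jumpMeasure_allowed hT, mul_inv_cancel_left₀ (partitionFunction_pos N hT).ne',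
      Set.inter_comm, ← Measure.restrict_apply hm, ← Measure.map_apply (measurable_endpoints N T) hms]
    change (endpointMeasure N T).real _ = _
    rw [endpointMeasure_real_apply hT]
    refine tsum_congr fun y => ?_
    simp [Set.indicator_apply]
  rw [correlation, Finset.mul_sum, Finset.sum_congr rfl fun f _ => h1 f, ← Summable.tsum_finsetSum]
  · simp only [Finset.sum_mul]
  · intro f _
    refine Summable.of_nonneg_of_le (fun y => ?_) (fun y => ?_) hsum
    · exact mul_nonneg (by split_ifs <;> simp) (lineWeight_nonneg hT y)
    · split_ifs
      · simp
      · simpa using lineWeight_nonneg hT y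

end JumpMeasure

end PNG

namespace PNG

open Equiv Matrix Filter Topology

/-! ### The generating functional as a Pfaffian. -/

section Series

theorem Phi_nonneg {T : ℝ} (hT : 0 < T) (x i : ℤ) : 0 ≤ Phi T x i := by
  unfold Phi Ttilde
  split_ifs <;> positivity

theorem summable_Phi (T : ℝ) (i : ℤ) : Summable fun x => Phi T x i := by
  have hinj : Function.Injective fun n : ℕ => i + (n : ℤ) := fun a b h => by simpa using h
  rw [← hinj.summable_iff]
  · refine (Real.summable_pow_div_factorial (Ttilde T)).congr fun n => ?_
    simp [Phi]
  · intro x hx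
    rw [Phi, if_neg]
    intro hle
    exact hx ⟨(x - i).toNat, by simp [hle]⟩

theorem summable_Phi_mul {T : ℝ} (hT : 0 < T) (i x : ℤ) : Summable fun z => Phi T z i * S x z := by
  refine Summable.of_norm_bounded (summable_Phi T i) fun z => ?_
  rw [norm_mul, Real.norm_of_nonneg (Phi_nonneg hT z i)]
  exact mul_le_of_le_one_right (Phi_nonneg hT z i) (abs_S_le_one x z)

theorem summable_weighted {T : ℝ} (hT : 0 < T) {c : ℤ → ℝ} {C : ℝ} (hc : ∀ z, |c z| ≤ C) (i j : ℤ) :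
    Summable fun p : ℤ × ℤ => Phi T p.1 i * c p.1 * S p.1 p.2 * (Phi T p.2 j * c p.2) := by
  have h := ((summable_Phi T i).mul_of_nonneg (summable_Phi T j) (fun z => Phi_nonneg hT z i)
    fun z => Phi_nonneg hT z j).mul_left (C * C)
  refine Summable.of_norm_bounded h fun p => ?_
  have hC : 0 ≤ C := (abs_nonneg _).trans (hc 0)
  rw [norm_mul, norm_mul, norm_mul, norm_mul, Real.norm_of_nonneg (Phi_nonneg hT p.1 i),
    Real.norm_of_nonneg (Phi_nonneg hT p.2 j)]
  have h1 : ‖S p.1 p.2‖ ≤ 1 := abs_S_le_one _ _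
  have hP := Phi_nonneg hT p.1 i
  have hQ := Phi_nonneg hT p.2 j
  calc Phi T p.1 i * ‖c p.1‖ * ‖S p.1 p.2‖ * (Phi T p.2 j * ‖c p.2‖)
      ≤ Phi T p.1 i * C * 1 * (Phi T p.2 j * C) := by
        gcongr
        · exact hc _
        · exact hc _
    _ = C * C * (Phi T p.1 i * Phi T p.2 j) := by ring

theorem summable_PhiSPhi {T : ℝ} (hT : 0 < T) (i j : ℤ) :
    Summable fun p : ℤ × ℤ => Phi T p.1 i * S p.1 p.2 * Phi T p.2 j := by
  simpa using summable_weighted hT (c := fun _ => 1) (C := 1) (by simp) i j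

theorem PhiSPhi_antisymm (T : ℝ) (i j : ℤ) : PhiSPhi T j i = -PhiSPhi T i j := by
  rw [PhiSPhi, PhiSPhi, ← (Equiv.prodComm ℤ ℤ).tsum_eq, ← tsum_neg]
  refine tsum_congr fun p => ?_
  simp only [prodComm_apply, Prod.fst_swap, Prod.snd_swap]
  rw [S_antisymm p.1 p.2]
  ring

theorem transpose_A (N : ℕ) (T : ℝ) : (A N T)ᵀ = -A N T := by
  ext i j
  simp only [A, transpose_apply, of_apply, Matrix.neg_apply]
  exact PhiSPhi_antisymm _ _ _

/-- Allows the double series to be truncated to squares `s ×ˢ s`, where the finite de Bruijn formula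
applies. -/
theorem tendsto_product_atTop :
    Tendsto (fun s : Finset ℤ => s ×ˢ s) atTop (atTop : Filter (Finset (ℤ × ℤ))) := by
  classical
  refine tendsto_atTop.2 fun t => ?_
  filter_upwards [eventually_ge_atTop (t.image Prod.fst ∪ t.image Prod.snd)] with s hs p hp
  rw [Finset.mem_product]
  exact ⟨hs (Finset.mem_union_left _ (Finset.mem_image_of_mem _ hp)),
    hs (Finset.mem_union_right _ (Finset.mem_image_of_mem _ hp))⟩

theorem tendsto_piFinset_atTop (m : ℕ) :
    Tendsto (fun s : Finset ℤ => Fintype.piFinset fun _ : Fin m => s) atTop atTop := by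
  classical
  refine tendsto_atTop.2 fun t => ?_
  filter_upwards [eventually_ge_atTop (Finset.univ.biUnion fun a : Fin m => t.image fun y => y a)]
    with s hs y hy
  rw [Fintype.mem_piFinset]
  exact fun a => hs (Finset.mem_biUnion.2 ⟨a, Finset.mem_univ _, Finset.mem_image_of_mem _ hy⟩)

theorem tendsto_pfSum {α ι κ : Type*} [Fintype ι] [Fintype κ] [DecidableEq κ] {l : Filter α}
    (e : ι × Fin 2 ≃ κ) {M : α → Matrix κ κ ℝ} {M' : Matrix κ κ ℝ}
    (h : ∀ a b, Tendsto (fun s => M s a b) l (𝓝 (M' a b))) :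
    Tendsto (fun s => pfSum e (M s)) l (𝓝 (pfSum e M')) :=
  tendsto_finsetSum _ fun _ _ => tendsto_const_nhds.mul (tendsto_finsetProd _ fun _ _ => h _ _)

/-- The matrix `A` with the additional weight `c` at each point of `ℤ`. -/
noncomputable def weightedA (N : ℕ) (T : ℝ) (c : ℤ → ℝ) : Matrix (Fin (2 * N)) (Fin (2 * N)) ℝ :=
  of fun i j => ∑' p : ℤ × ℤ,
    Phi T p.1 (level N i) * c p.1 * S p.1 p.2 * (Phi T p.2 (level N j) * c p.2)

theorem weightedA_one (N : ℕ) (T : ℝ) : weightedA N T (fun _ => 1) = A N T := by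
  ext i j
  simp [weightedA, A, PhiSPhi]

/-- De Bruijn's formula on a finite `s ⊆ ℤ`, followed by the limit over `s`. The weights `c` factor
out of the columns of the determinant, and the Pfaffian of `S` selects the allowed parities. -/
theorem pfSum_weightedA (N : ℕ) {T : ℝ} (hT : 0 < T) {c : ℤ → ℝ} {C : ℝ} (hc : ∀ z, |c z| ≤ C) :
    pfSum (linePairing N) (weightedA N T c) =
      (-1) ^ N * (2 ^ N * (N.factorial : ℝ)) * ∑' y, lineWeight N T y * ∏ a, c (y a) := by
  classical
  have hC : 0 ≤ C := (abs_nonneg _).trans (hc 0)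
  have hsum : Summable fun y => lineWeight N T y * ∏ a, c (y a) := by
    refine Summable.of_norm_bounded ((summable_lineWeight N hT).mul_right (C ^ (2 * N))) fun y => ?_
    rw [norm_mul, Real.norm_of_nonneg (lineWeight_nonneg hT y), norm_prod]
    refine mul_le_mul_of_nonneg_left ?_ (lineWeight_nonneg hT y)
    calc ∏ a, ‖c (y a)‖ ≤ ∏ _a : Fin (2 * N), C :=
          Finset.prod_le_prod (fun _ _ => norm_nonneg _) fun a _ => hc _
      _ = C ^ (2 * N) := by simp
  have hleft : Tendsto (fun s : Finset ℤ => pfSum (linePairing N) (of fun i j =>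
      ∑ p ∈ s, ∑ q ∈ s, (Phi T p (level N i) * c p) * S p q * (Phi T q (level N j) * c q)))
      atTop (𝓝 (pfSum (linePairing N) (weightedA N T c))) := by
    refine tendsto_pfSum _ fun i j => ?_
    have := (summable_weighted hT hc (level N i) (level N j)).hasSum.comp tendsto_product_atTop
    refine this.congr fun s => ?_
    simp only [Function.comp, Finset.sum_product, of_apply]
  have hright : Tendsto (fun s : Finset ℤ => pfSum (linePairing N) (of fun i j =>
      ∑ p ∈ s, ∑ q ∈ s, (Phi T p (level N i) * c p) * S p q * (Phi T q (level N j) * c q)))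
      atTop (𝓝 ((-1) ^ N * (2 ^ N * (N.factorial : ℝ)) *
        ∑' y, lineWeight N T y * ∏ a, c (y a))) := by
    have := (hsum.hasSum.comp (tendsto_piFinset_atTop (2 * N))).const_mul
      ((-1) ^ N * (2 ^ N * (N.factorial : ℝ)))
    refine this.congr fun s => ?_
    rw [pfSum_deBruijn (linePairing N) (fun i p => Phi T p (level N i) * c p) S s,
      Finset.sum_filter, Function.comp, Finset.mul_sum]
    refine Finset.sum_congr rfl fun y _ => ?_
    have hdet : (of fun a b => Phi T (y b) (level N a) * c (y b)).det =
        (∏ a, c (y a)) * kmDet N T y := by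
      rw [kmDet, ← det_mul_row]
      congr 1
      ext a b
      simp [mul_comm]
    rw [hdet]
    by_cases hy : StrictMono y
    · rw [if_pos hy, lineWeight]
      by_cases hp : ∀ j, Even (y j - level N j)
      · rw [if_pos ⟨hy, hp⟩, pfSum_S_alternating N y hy hp]
        ring
      · rw [if_neg (fun h => hp h.2), pfSum_S_not_alternating N y hy hp]
        ring
    · rw [if_neg hy, lineWeight, if_neg (fun h => hy h.1)]
      ring
  exact tendsto_nhds_unique hleft hright

theorem pfSum_A (N : ℕ) {T : ℝ} (hT : 0 < T) :
    pfSum (linePairing N) (A N T) =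
      (-1) ^ N * (2 ^ N * (N.factorial : ℝ)) * partitionFunction N T := by
  rw [← weightedA_one, pfSum_weightedA N hT (C := 1) (by simp)]
  simp [partitionFunction]

theorem isUnit_det_A (N : ℕ) {T : ℝ} (hT : 0 < T) : IsUnit (A N T).det := by
  refine isUnit_iff_ne_zero.2 (det_ne_zero_of_pfSum_ne_zero (linePairing N) _ (transpose_A N T) ?_)
  rw [pfSum_A N hT]
  have := (partitionFunction_pos N hT).ne'
  positivity

theorem transpose_inv_A (N : ℕ) {T : ℝ} (hT : 0 < T) : ((A N T)⁻¹)ᵀ = -(A N T)⁻¹ := by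
  have h := isUnit_det_A N hT
  rw [transpose_nonsing_inv, transpose_A]
  refine inv_eq_left_inv ?_
  simp [nonsing_inv_mul _ h]

theorem K12_eq_neg_K21 (N : ℕ) {T : ℝ} (hT : 0 < T) (x y : ℤ) : K12 N T x y = -K21 N T y x := by
  have h : ∀ i j, (A N T)⁻¹ j i = -(A N T)⁻¹ i j := fun i j =>
    congrFun (congrFun (transpose_inv_A N hT) i) j
  rw [K12, K21, Finset.sum_comm, neg_neg, ← Finset.sum_neg_distrib]
  refine Finset.sum_congr rfl fun i _ => ?_
  rw [← Finset.sum_neg_distrib]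
  refine Finset.sum_congr rfl fun j _ => ?_
  rw [h]
  ring

end Series

/-! ### Perturbing the weight at finitely many points. -/

section FinitePerturbation

variable {n : ℕ}

/-- The weight `1 + t` at the points `x₁, …, xₙ` (with multiplicities) and `1` elsewhere. -/
noncomputable def pointWeight (t : ℝ) (x : Fin n → ℤ) (z : ℤ) : ℝ :=
  1 + t * ∑ a, if z = x a then 1 else 0

theorem abs_pointWeight_le (t : ℝ) (x : Fin n → ℤ) (z : ℤ) : |pointWeight t x z| ≤ 1 + |t| * n := by
  have h0 : (0 : ℝ) ≤ ∑ a, if z = x a then 1 else 0 :=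
    Finset.sum_nonneg fun a _ => by split_ifs <;> simp
  have h1 : (∑ a, if z = x a then (1 : ℝ) else 0) ≤ n := by
    calc (∑ a, if z = x a then (1 : ℝ) else 0) ≤ ∑ _a : Fin n, (1 : ℝ) :=
          Finset.sum_le_sum fun a _ => by split_ifs <;> simp
      _ = n := by simp
  unfold pointWeight
  refine (abs_add_le _ _).trans ?_
  rw [abs_one, abs_mul, abs_of_nonneg h0]
  gcongr

/-- The matrix with rows `Φ_{x_a, ·}` and `[Φᵗ Sᵗ]_{·, x_a}`. -/
noncomputable def pointRows (N : ℕ) (T : ℝ) (x : Fin n → ℤ) :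
    Matrix (Fin n ⊕ Fin n) (Fin (2 * N)) ℝ :=
  fromRows (of fun a i => Phi T (x a) (level N i)) (of fun a i => PhiSt T (level N i) (x a))

/-- The matrix `S` at the points `x₁, …, xₙ`. -/
noncomputable def pointS (x : Fin n → ℤ) : Matrix (Fin n) (Fin n) ℝ := of fun a b => S (x a) (x b)

/-- The matrix `[[0, -s], [s, S]]` at the points `x₁, …, xₙ`. -/
noncomputable def pointBlock (s : ℝ) (x : Fin n → ℤ) : Matrix (Fin n ⊕ Fin n) (Fin n ⊕ Fin n) ℝ :=
  fromBlocks 0 (-(s • 1)) (s • 1) (pointS x)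

/-- The matrix `[[t² S, t], [-t, 0]]`, which is the inverse of `pointBlock t⁻¹ x`. -/
noncomputable def pointBlockInv (t : ℝ) (x : Fin n → ℤ) :
    Matrix (Fin n ⊕ Fin n) (Fin n ⊕ Fin n) ℝ :=
  fromBlocks (t ^ 2 • pointS x) (t • 1) (-(t • 1)) 0

theorem hasSum_row (F : ℤ × ℤ → ℝ) (z : ℤ) {v : ℝ} (h : HasSum (fun q => F (z, q)) v) :
    HasSum (fun p : ℤ × ℤ => F p * if p.1 = z then 1 else 0) v := by
  have hinj : Function.Injective fun q : ℤ => (z, q) := fun a b h => (Prod.mk.inj h).2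
  rw [← hinj.hasSum_iff]
  · simpa [Function.comp_def] using h
  · rintro ⟨p, q⟩ hp
    have : p ≠ z := by rintro rfl; exact hp ⟨q, rfl⟩
    simp [this]

theorem hasSum_column (F : ℤ × ℤ → ℝ) (z : ℤ) {v : ℝ} (h : HasSum (fun p => F (p, z)) v) :
    HasSum (fun p : ℤ × ℤ => F p * if p.2 = z then 1 else 0) v := by
  have := hasSum_row (fun p => F p.swap) z h
  rw [← (Equiv.prodComm ℤ ℤ).hasSum_iff] at this
  simpa [Function.comp_def] using this

/-- Expand the product of the two weights. The terms linear in `t` restrict one summation variable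
to some `x a` and give `Φ` times `Φᵗ Sᵗ`, with a minus sign from the antisymmetry of `S` in the
column case. The quadratic term gives `t² S(x_a, x_b)`. -/
theorem weightedA_pointWeight (N : ℕ) {T : ℝ} (hT : 0 < T) (t : ℝ) (x : Fin n → ℤ) :
    weightedA N T (pointWeight t x) = A N T + (pointRows N T x)ᵀ *
      pointBlockInv t x * pointRows N T x := by
  ext i j
  set F : ℤ × ℤ → ℝ := fun p => Phi T p.1 (level N i) * S p.1 p.2 * Phi T p.2 (level N j) with hF
  have hA : HasSum F (A N T i j) := (summable_PhiSPhi hT (level N i) (level N j)).hasSum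
  have hrow : ∀ a, HasSum (fun p : ℤ × ℤ => F p * if p.1 = x a then 1 else 0)
      (Phi T (x a) (level N i) * PhiSt T (level N j) (x a)) := by
    intro a
    refine hasSum_row F (x a) ?_
    have := (summable_Phi_mul hT (level N j) (x a)).hasSum.mul_left (Phi T (x a) (level N i))
    refine HasSum.congr_fun this fun q => ?_
    change Phi T (x a) (level N i) * S (x a) q * Phi T q (level N j) = _
    ring
  have hcol : ∀ a, HasSum (fun p : ℤ × ℤ => F p * if p.2 = x a then 1 else 0)
      (-(PhiSt T (level N i) (x a) * Phi T (x a) (level N j))) := by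
    intro a
    refine hasSum_column F (x a) ?_
    have := ((summable_Phi_mul hT (level N i) (x a)).hasSum.mul_right (Phi T (x a) (level N j))).neg
    refine HasSum.congr_fun this fun p => ?_
    change Phi T p (level N i) * S p (x a) * Phi T (x a) (level N j) = _
    rw [S_antisymm (x a) p]; ring
  have hpt : ∀ a b, HasSum (fun p : ℤ × ℤ => F p *
      ((if p.1 = x a then 1 else 0) * if p.2 = x b then 1 else 0)) (F (x a, x b)) := by
    intro a b
    have := hasSum_single (f := fun p : ℤ × ℤ => F p *
      ((if p.1 = x a then 1 else 0) * if p.2 = x b then 1 else 0)) (x a, x b) (by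
        rintro ⟨p, q⟩ hpq
        by_cases h1 : p = x a
        · have h2 : q ≠ x b := fun h2 => hpq (by rw [h1, h2])
          simp [h2]
        · simp [h1])
    simpa using this
  have htot := (hA.add (((hasSum_sum fun a (_ : a ∈ Finset.univ) => hrow a).mul_left t).add
    ((hasSum_sum fun a (_ : a ∈ Finset.univ) => hcol a).mul_left t))).add
    ((hasSum_sum fun a (_ : a ∈ Finset.univ) =>
      hasSum_sum fun b (_ : b ∈ Finset.univ) => hpt a b).mul_left (t ^ 2))
  have hfun : ∀ p : ℤ × ℤ, F p + (t * ∑ a, (F p * if p.1 = x a then 1 else 0) +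
      t * ∑ a, (F p * if p.2 = x a then 1 else 0)) +
      t ^ 2 * ∑ a, ∑ b, (F p * ((if p.1 = x a then 1 else 0) * if p.2 = x b then 1 else 0)) =
      Phi T p.1 (level N i) * pointWeight t x p.1 * S p.1 p.2 *
        (Phi T p.2 (level N j) * pointWeight t x p.2) := by
    intro p
    simp only [← Finset.mul_sum, ← Finset.sum_mul, pointWeight, hF]
    ring
  simp only [hfun] at htot
  rw [weightedA, of_apply, htot.tsum_eq, Matrix.add_apply, add_assoc]
  congr 1
  rw [Matrix.mul_assoc, pointRows, pointBlockInv, fromBlocks_mul_fromRows, transpose_fromRows,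
    fromCols_mul_fromRows, Matrix.add_apply]
  simp only [Matrix.mul_apply, Matrix.add_apply, transpose_apply, of_apply, pointS,
    Matrix.smul_apply, smul_eq_mul, Matrix.smul_mul, Matrix.one_mul, Matrix.neg_mul,
    Matrix.neg_apply, Matrix.zero_mul, add_zero, Finset.mul_sum, hF, mul_add,
    Finset.sum_add_distrib]
  simp only [← Finset.sum_add_distrib]
  refine Finset.sum_congr rfl fun a _ => ?_
  rw [show ∀ u v w : ℝ, u + v + w = w + u + v from fun u v w => by ring]
  congr 1
  · congr 1
    · exact Finset.sum_congr rfl fun b _ => by ring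
    · ring
  · ring

theorem transpose_pointS (x : Fin n → ℤ) : (pointS x)ᵀ = -pointS x := by
  ext a b
  exact S_antisymm _ _

theorem pfSum_pointBlock {s : ℝ} (hs : s ≠ 0) (x : Fin n → ℤ) :
    pfSum (doublePairing (Fin n)) (pointBlock s x) =
      2 ^ n * (n.factorial : ℝ) * (-s) ^ n := by
  -- A shear by an antisymmetric block `X` creates the lower right block `-s (X - Xᵀ) = -2 s X`,
  -- which must equal `pointS x`.
  let B : Matrix (Fin n ⊕ Fin n) (Fin n ⊕ Fin n) ℝ := fromBlocks 1 0 ((-(2 * s)⁻¹) • pointS x) 1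
  let P : Matrix (Fin n) (Fin n) ℝ := -(s • 1)
  let Q : Matrix (Fin n ⊕ Fin n) (Fin n ⊕ Fin n) ℝ := fromBlocks 0 P (-Pᵀ) 0
  have h : B * Q * Bᵀ = pointBlock s x := by
    simp only [B, Q, P, pointBlock, fromBlocks_transpose, fromBlocks_multiply, transpose_smul,
      transpose_pointS, transpose_neg, transpose_one, transpose_zero]
    congr 1
    · simp
    · simp
    · simp
    · ext a b
      simp
      field_simp
      ring
  rw [← h, pfSum_congruence, pfSum_fromBlocks_zero_diag, det_fromBlocks_zero₁₂]
  simp [P, ← neg_smul]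

end FinitePerturbation

end PNG

namespace PNG

open Equiv Matrix Filter Topology

/-! ### The Schur complement identity and the limit to the correlation functions. -/

section Limit

variable {n : ℕ}

theorem transpose_pointBlock (s : ℝ) (x : Fin n → ℤ) : (pointBlock s x)ᵀ = -pointBlock s x := by
  simp [pointBlock, fromBlocks_transpose, fromBlocks_neg, transpose_pointS]

theorem pointBlock_mul_inv {s : ℝ} (hs : s ≠ 0) (x : Fin n → ℤ) :
    pointBlock s x * pointBlockInv s⁻¹ x = 1 := by
  rw [pointBlock, pointBlockInv, fromBlocks_multiply, ← fromBlocks_one]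
  congr 1
  · simp [smul_smul, hs]
  · simp
  · ext a b
    simp
    field_simp
    ring
  · simp [smul_smul, hs]

/-- The matrix of the kernel at the points `x₁, …, xₙ`, the first components first. -/
noncomputable def kernelBlocks (N : ℕ) (T : ℝ) (x : Fin n → ℤ) :
    Matrix (Fin n ⊕ Fin n) (Fin n ⊕ Fin n) ℝ :=
  fromBlocks (of fun a b => K11 N T (x a) (x b)) (of fun a b => K12 N T (x a) (x b))
    (of fun a b => K21 N T (x a) (x b)) (of fun a b => K22 N T (x a) (x b))

/-- The standard symplectic form. -/
def symplecticForm (n : ℕ) : Matrix (Fin n ⊕ Fin n) (Fin n ⊕ Fin n) ℝ := fromBlocks 0 1 (-1) 0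

theorem pfaffian_blockMatrix (N : ℕ) (T : ℝ) (x : Fin n → ℤ) :
    pfaffian (blockMatrix (K N T) x) =
      pfSum (doublePairing (Fin n)) (kernelBlocks N T x) / (2 ^ n * (n.factorial : ℝ)) := by
  have h1 : pfaffian (blockMatrix (K N T) x) =
      pfSum (Equiv.refl _) (blockMatrix (K N T) x) / (2 ^ n * (n.factorial : ℝ)) := rfl
  have h2 : (kernelBlocks N T x).submatrix (doublePairing (Fin n)) (doublePairing (Fin n)) =
      blockMatrix (K N T) x := by
    ext ⟨i, a⟩ ⟨j, b⟩
    fin_cases a <;> fin_cases b <;> simp [kernelBlocks, blockMatrix, K]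
  rw [h1, ← h2, pfSum_reindex (Equiv.refl _) (doublePairing (Fin n)) (doublePairing (Fin n))
    (Equiv.refl _) (fun _ _ => rfl)]

theorem pointBlock_add_rows (N : ℕ) (T s : ℝ) (x : Fin n → ℤ) :
    pointBlock s x + pointRows N T x * (A N T)⁻¹ * (pointRows N T x)ᵀ =
      (-1 : ℝ) • (kernelBlocks N T x + s • symplecticForm n) := by
  have hbil : ∀ u v : Fin (2 * N) → ℝ, ∑ j, (∑ i, u i * (A N T)⁻¹ i j) * v j =
      ∑ i, ∑ j, u i * (A N T)⁻¹ i j * v j := by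
    intro u v
    simp only [Finset.sum_mul]
    exact Finset.sum_comm
  ext a b
  rcases a with a | a <;> rcases b with b | b
  · simp [pointBlock, pointRows, kernelBlocks, symplecticForm, Matrix.mul_apply, hbil, K11]
  · simp [pointBlock, pointRows, kernelBlocks, symplecticForm, Matrix.mul_apply, hbil, K12]
  · simp [pointBlock, pointRows, kernelBlocks, symplecticForm, Matrix.mul_apply, hbil, K21]
  · simp [pointBlock, pointRows, kernelBlocks, symplecticForm, Matrix.mul_apply, hbil, K22, pointS,
      S_antisymm (x a) (x b), add_comm]

/-- The Schur complement identity with `V = pointBlock s x` and `C = pointRows N T x`. The parameter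
`s ≠ 0` makes `V` invertible, with exactly the inverse that appears in `weightedA_pointWeight` for
`t = s⁻¹`. -/
theorem pfSum_kernelBlocks_perturbed (N : ℕ) {T : ℝ} (hT : 0 < T) {s : ℝ} (hs : s ≠ 0)
    (x : Fin n → ℤ) :
    pfSum (doublePairing (Fin n)) (kernelBlocks N T x + s • symplecticForm n) *
        partitionFunction N T =
      2 ^ n * (n.factorial : ℝ) *
        ∑' y, s ^ n * (lineWeight N T y * ∏ a, pointWeight s⁻¹ x (y a)) := by
  have h := pfSum_schur_complement (doublePairing (Fin n)) (linePairing N) (pointBlock s x)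
    (pointBlockInv s⁻¹ x) (A N T) (A N T)⁻¹ (pointRows N T x) (transpose_pointBlock s x)
    (transpose_A N T) (pointBlock_mul_inv hs x) (mul_nonsing_inv _ (isUnit_det_A N hT))
  have hchoose : ((Fintype.card (Fin n) + Fintype.card (Fin N)).choose (Fintype.card (Fin n)) : ℝ)
      ≠ 0 := Nat.cast_ne_zero.2 (Nat.choose_pos (Nat.le_add_right _ _)).ne'
  have h' := mul_left_cancel₀ hchoose h
  rw [pointBlock_add_rows, pfSum_smul, Fintype.card_fin, pfSum_A N hT, pfSum_pointBlock hs,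
    ← weightedA_pointWeight N hT, pfSum_weightedA N hT (abs_pointWeight_le s⁻¹ x)] at h'
  rw [tsum_mul_left]
  have hc : (-1 : ℝ) ^ n * ((-1) ^ N * (2 ^ N * (N.factorial : ℝ))) ≠ 0 := by positivity
  refine mul_left_cancel₀ hc ?_
  rw [neg_pow s n] at h'
  linear_combination h'

theorem one_add_sum_eq_prod {ι : Type*} [Fintype ι] {g : ι → ℤ} (hg : Function.Injective g)
    (t : ℝ) (z : ℤ) :
    (1 + t * ∑ i, if z = g i then 1 else 0) = ∏ i, if z = g i then 1 + t else 1 := by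
  classical
  by_cases h : ∃ i, z = g i
  · obtain ⟨i, rfl⟩ := h
    simp [hg.eq_iff]
  · push Not at h
    simp [h]

/-- By injectivity each weight `1 + s⁻¹ ∑` is a product over the matching indices, so the products
over `x` and `y` can be exchanged. The right-hand side is polynomial in `s`, so `s → 0` makes sense.
-/
theorem scaled_prod_pointWeight {m : ℕ} {s : ℝ} (hs : s ≠ 0) {x : Fin n → ℤ} {y : Fin m → ℤ}
    (hx : Function.Injective x) (hy : Function.Injective y) :
    s ^ n * ∏ a, pointWeight s⁻¹ x (y a) = ∏ i, (s + ∑ a, if x i = y a then 1 else 0) := by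
  simp only [pointWeight, one_add_sum_eq_prod hx]
  rw [Finset.prod_comm]
  have h : ∀ i, (∏ a, if y a = x i then 1 + s⁻¹ else 1) =
      1 + s⁻¹ * ∑ a, if x i = y a then 1 else 0 := by
    intro i
    rw [one_add_sum_eq_prod hy]
    simp only [eq_comm]
  simp only [h]
  have h2 : s ^ n = ∏ _i : Fin n, s := by simp
  rw [h2, ← Finset.prod_mul_distrib]
  refine Finset.prod_congr rfl fun i _ => ?_
  field_simp

theorem prod_sum_eq_card_embeddings {m : ℕ} {x : Fin n → ℤ} (hx : Function.Injective x)
    (y : Fin m → ℤ) :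
    (∏ i, ∑ a, if x i = y a then (1 : ℝ) else 0) =
      ∑ f : Fin n ↪ Fin m, if ∀ i, y (f i) = x i then 1 else 0 := by
  classical
  rw [Finset.prod_univ_sum, Fintype.piFinset_univ]
  have hprod : ∀ f : Fin n → Fin m, (∏ i, if x i = y (f i) then (1 : ℝ) else 0) =
      if ∀ i, y (f i) = x i then 1 else 0 := by
    intro f
    split_ifs with h
    · exact Finset.prod_eq_one fun i _ => by simp [h i]
    · push Not at h
      obtain ⟨i, hi⟩ := h
      exact Finset.prod_eq_zero (Finset.mem_univ i) (by simp [hi.symm])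
  simp only [hprod]
  symm
  refine Finset.sum_of_injOn (fun f : Fin n ↪ Fin m => (f : Fin n → Fin m))
    (DFunLike.coe_injective.injOn) (by simp) ?_ (fun _ _ => rfl)
  intro f _ hf
  rw [if_neg]
  intro h
  -- A choice function with `y ∘ f = x` is automatically injective because `x` is.
  refine hf ⟨⟨f, fun i j hij => hx ?_⟩, by simp, rfl⟩
  rw [← h i, ← h j, hij]

theorem sum_ite_le_one {m : ℕ} {y : Fin m → ℤ} (hy : Function.Injective y) (z : ℤ) :
    (∑ a, if z = y a then (1 : ℝ) else 0) ≤ 1 := by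
  classical
  by_cases h : ∃ a, z = y a
  · obtain ⟨a, rfl⟩ := h
    simp [hy.eq_iff]
  · push Not at h
    simp [h]

theorem tendsto_weighted_sum (N : ℕ) {T : ℝ} (hT : 0 < T) {x : Fin n → ℤ}
    (hx : Function.Injective x) :
    Tendsto (fun s : ℝ => ∑' y, s ^ n * (lineWeight N T y * ∏ a, pointWeight s⁻¹ x (y a)))
      (𝓝[>] 0) (𝓝 (∑' y, (∑ f : Fin n ↪ Fin (2 * N), if ∀ i, y (f i) = x i then 1 else 0) *
        lineWeight N T y)) := by
  have hform : ∀ (s : ℝ), s ≠ 0 → ∀ y,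
      s ^ n * (lineWeight N T y * ∏ a, pointWeight s⁻¹ x (y a)) =
        (∏ i, (s + ∑ a, if x i = y a then 1 else 0)) * lineWeight N T y := by
    intro s hs y
    by_cases hy : StrictMono y
    · rw [← scaled_prod_pointWeight hs hx hy.injective]
      ring
    · have : lineWeight N T y = 0 := if_neg fun h => hy h.1
      simp [this]
  -- For `0 < s < 1` each factor `s + #{a : y_a = x_i}` is at most `2`, since `y` is injective
  -- wherever the weight is nonzero.
  refine tendsto_tsum_of_dominated_convergence (bound := fun y => 2 ^ n * lineWeight N T y)
    ((summable_lineWeight N hT).mul_left _) (fun y => ?_) ?_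
  · have hcont : Tendsto (fun s : ℝ => (∏ i, (s + ∑ a, if x i = y a then (1 : ℝ) else 0)) *
        lineWeight N T y) (𝓝[>] 0)
        (𝓝 ((∏ i, (0 + ∑ a, if x i = y a then (1 : ℝ) else 0)) * lineWeight N T y)) := by
      refine Tendsto.mono_left (Continuous.tendsto ?_ 0) nhdsWithin_le_nhds
      fun_prop
    simp only [zero_add] at hcont
    rw [prod_sum_eq_card_embeddings hx y] at hcont
    refine hcont.congr' ?_
    filter_upwards [self_mem_nhdsWithin] with s hs
    exact (hform s (ne_of_gt hs) y).symm
  · filter_upwards [Ioo_mem_nhdsGT (zero_lt_one' ℝ)] with s hs y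
    rw [hform s hs.1.ne' y]
    by_cases hy : StrictMono y
    swap
    · have : lineWeight N T y = 0 := if_neg fun h => hy h.1
      simp [this]
    have h0 : ∀ i, 0 ≤ s + ∑ a, if x i = y a then (1 : ℝ) else 0 := fun i =>
      add_nonneg hs.1.le (Finset.sum_nonneg fun a _ => by split_ifs <;> simp)
    rw [norm_mul, Real.norm_of_nonneg (lineWeight_nonneg hT y),
      Real.norm_of_nonneg (Finset.prod_nonneg fun i _ => h0 i)]
    refine mul_le_mul_of_nonneg_right ?_ (lineWeight_nonneg hT y)
    calc (∏ i, (s + ∑ a, if x i = y a then (1 : ℝ) else 0)) ≤ ∏ _i : Fin n, (2 : ℝ) :=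
          Finset.prod_le_prod (fun i _ => h0 i) fun i _ => by
            have := sum_ite_le_one hy.injective (x i)
            linarith [hs.2]
      _ = 2 ^ n := by simp

theorem correlation_eq_pfaffian_of_injective (N : ℕ) {T : ℝ} (hT : 0 < T) {x : Fin n → ℤ}
    (hx : Function.Injective x) :
    correlation N T n x = pfaffian (blockMatrix (K N T) x) := by
  have hZ := (partitionFunction_pos N hT).ne'
  have h1 := (tendsto_weighted_sum N hT hx).const_mul (2 ^ n * (n.factorial : ℝ))
  rw [← correlation_eq hT n x] at h1
  have h2 : Tendsto (fun s : ℝ => pfSum (doublePairing (Fin n))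
      (kernelBlocks N T x + s • symplecticForm n) * partitionFunction N T) (𝓝[>] 0)
      (𝓝 (pfSum (doublePairing (Fin n)) (kernelBlocks N T x) * partitionFunction N T)) := by
    refine Tendsto.mul_const _ (tendsto_pfSum _ fun a b => ?_)
    have : Continuous fun s : ℝ => (kernelBlocks N T x + s • symplecticForm n) a b := by
      simp only [Matrix.add_apply, Matrix.smul_apply, smul_eq_mul]
      fun_prop
    simpa using (this.tendsto 0).mono_left (nhdsWithin_le_nhds (s := Set.Ioi 0))
  have h3 := tendsto_nhds_unique h1 (h2.congr' (by
    filter_upwards [self_mem_nhdsWithin] with s hs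
    exact pfSum_kernelBlocks_perturbed N hT (ne_of_gt hs) x))
  rw [pfaffian_blockMatrix, eq_div_iff (by positivity)]
  refine mul_left_cancel₀ hZ ?_
  linear_combination h3

theorem correlation_eq_pfaffian_of_not_injective (N : ℕ) {T : ℝ} (hT : 0 < T) {x : Fin n → ℤ}
    (hx : ¬Function.Injective x) :
    correlation N T n x = pfaffian (blockMatrix (K N T) x) := by
  simp only [Function.Injective, not_forall] at hx
  obtain ⟨i, j, hij, hne⟩ := hx
  have hleft : partitionFunction N T * correlation N T n x = 0 := by
    rw [correlation_eq hT]
    refine (tsum_congr fun y => ?_).trans tsum_zero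
    by_cases hy : StrictMono y
    · rw [Finset.sum_eq_zero, zero_mul]
      intro f _
      refine if_neg fun h => hne (f.injective (hy.injective ?_))
      rw [h i, h j, hij]
    · have : lineWeight N T y = 0 := if_neg fun h => hy h.1
      simp [this]
  -- Equal points give equal rows and columns of the block matrix.
  have hright : pfSum (Equiv.refl _) (blockMatrix (K N T) x) = 0 := by
    refine pfSum_eq_zero_of_rows_eq _ _ (p := (i, 0)) (q := (j, 0)) (fun h => hne (Prod.mk.inj h).1)
      (fun r => ?_) fun r => ?_ <;> simp [blockMatrix, hij]
  have h1 : pfaffian (blockMatrix (K N T) x) =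
      pfSum (Equiv.refl _) (blockMatrix (K N T) x) / (2 ^ n * (n.factorial : ℝ)) := rfl
  rw [h1, hright, zero_div]
  exact (mul_eq_zero.1 hleft).resolve_left (partitionFunction_pos N hT).ne'

end Limit

end PNG

theorem proposition4p1 (N : ℕ) (T : ℝ) (hT : 0 < T) :
    -- the line ensemble is well defined
    MeasureTheory.IsProbabilityMeasure (PNG.lineEnsemble N T) ∧
    -- the series over `ℤ` converge absolutely, `S` and `A` are antisymmetric, `A` is invertible
    (∀ i j : ℤ, Summable fun p : ℤ × ℤ => PNG.Phi T p.1 i * PNG.S p.1 p.2 * PNG.Phi T p.2 j) ∧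
    (∀ i x : ℤ, Summable fun z : ℤ => PNG.Phi T z i * PNG.S x z) ∧
    (∀ x y : ℤ, PNG.S y x = -PNG.S x y) ∧
    (PNG.A N T).transpose = -PNG.A N T ∧
    IsUnit (PNG.A N T).det ∧
    (∀ x y : ℤ, PNG.K12 N T x y = -PNG.K21 N T y x) ∧
    -- the correlation functions of the end points are Pfaffians
    ∀ n : ℕ, n ≤ 2 * N → ∀ x : Fin n → ℤ,
      PNG.correlation N T n x = PNG.pfaffian (PNG.blockMatrix (PNG.K N T) x) := by
  refine ⟨PNG.isProbabilityMeasure_lineEnsemble N hT, PNG.summable_PhiSPhi hT,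
    PNG.summable_Phi_mul hT, PNG.S_antisymm, PNG.transpose_A N T, PNG.isUnit_det_A N hT,
    PNG.K12_eq_neg_K21 N hT, fun n _ x => ?_⟩
  by_cases hx : Function.Injective x
  · exact PNG.correlation_eq_pfaffian_of_injective N hT hx
  · exact PNG.correlation_eq_pfaffian_of_not_injective N hT hx
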